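/- Let $E$ be a complex Banach lattice, i.e. the complexification $E = X \oplus iX$ of a real Banach lattice $X$, with norm $\|x+iy\| = \|\,|x+iy|\,\|$, where $|x+iy| = \sup_{\theta\in\mathbb{R}} (x\cos\theta + y\sin\theta) \in X$. Let $T$ be a bounded linear operator on $E$ which is positive ($Tx \ge 0$ whenever $0 \le x \in X$) and has spectral radius $r(T) = 1$. A \emph{weighting scheme} is a net $(f_j)_{j\in J}$ (indexed by a non-empty directed set) of functions $f_j : \overline{\mathbb{D}} \to \mathbb{C}$ on the closed unit disk, each having an analytic extension to an open neighbourhood of $\overline{\mathbb{D}}$, such that $f_j(1) = 1$ for all $j$; $f_j^{(k)}(0) \ge 0$ for all $j$ and all integers $k \ge 0$; and $|f_j(z)| \to 0$ along the net for every $z\in\mathbb{C}$ with $|z|<1$. The operator $T$ is called \emph{(WS)-bounded} if there is a weighting scheme $(f_j)_{j\in J}$ such that the set $\{f_j(T) : j \in J\}$, defined by the analytic functional calculus, is bounded in operator norm. If $T$ is (WS)-bounded, then its peripheral spectrum $\sigma_{\mathrm{per}}(T) = \{\lambda\in\sigma(T) : |\lambda| = r(T)\}$ is cyclic: whenever $re^{i\theta}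 \in \sigma_{\mathrm{per}}(T)$ with $r \ge 0$ and $\theta\in\mathbb{R}$, one has $re^{ik\theta} \in \sigma_{\mathrm{per}}(T)$ for all $k\in\mathbb{Z}$. -/

import Mathlib

universe w

/-- A complex Banach lattice `E` with real part `X`: the complex Banach space `E` is the
complexification `X ⊕ i X` of the real Banach lattice `X` (embedded by `ofReal`), with the norm
`‖x + i y‖ = ‖ |x + i y| ‖`, where the modulus of `x + i y` is the element
`|x + i y| = sup_θ (cos θ • x + sin θ • y)` of `X`. -/
structure ComplexBanachLattice (X E : Type*)
    [NormedAddCommGroup X] [Lattice X] [IsOrderedAddMonoid X] [HasSolidNorm X]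
    [NormedSpace ℝ X] [IsOrderedModule ℝ X] [CompleteSpace X]
    [NormedAddCommGroup E] [NormedSpace ℂ E] [CompleteSpace E] where
  /-- The inclusion of the real part. -/
  ofReal : X →ₗ[ℝ] E
  /-- Every element is `x + i y` for unique `x` and `y` in the real part. -/
  bijective : Function.Bijective fun p : X × X => ofReal p.1 + Complex.I • ofReal p.2
  /-- The norm of an element is the norm of its modulus. -/
  norm_eq : ∀ x y : X, ∃ m : X,
    IsLUB (Set.range fun θ : ℝ => Real.cos θ • x + Real.sin θ • y) m ∧
      ‖ofReal x + Complex.I • ofReal y‖ = ‖m‖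

/-- A bounded operator on a complex Banach lattice is positive if it maps the positive cone of
the real part into itself. -/
def ComplexBanachLattice.IsPositive {X E : Type*}
    [NormedAddCommGroup X] [Lattice X] [IsOrderedAddMonoid X] [HasSolidNorm X]
    [NormedSpace ℝ X] [IsOrderedModule ℝ X] [CompleteSpace X]
    [NormedAddCommGroup E] [NormedSpace ℂ E] [CompleteSpace E]
    (L : ComplexBanachLattice X E) (T : E →L[ℂ] E) : Prop :=
  ∀ x : X, 0 ≤ x → ∃ y : X, 0 ≤ y ∧ T (L.ofReal x) = L.ofReal y

/-- The peripheral spectrum: all spectral values of modulus equal to the spectral radius. -/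
def peripheralSpectrum {E : Type*} [NormedAddCommGroup E] [NormedSpace ℂ E]
    (T : E →L[ℂ] E) : Set ℂ :=
  {z : ℂ | z ∈ spectrum ℂ T ∧ ENNReal.ofReal ‖z‖ = spectralRadius ℂ T}

/-- A set `M` of complex numbers is cyclic if `r e^{iθ} ∈ M` with `r ≥ 0` and `θ` real implies
`r e^{ikθ} ∈ M` for all integers `k`. -/
def IsCyclicSet (M : Set ℂ) : Prop :=
  ∀ r θ : ℝ, 0 ≤ r → (r : ℂ) * Complex.exp (Complex.I * θ) ∈ M →
    ∀ k : ℤ, (r : ℂ) * Complex.exp (Complex.I * k * θ) ∈ M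

/-- A net of functions that are analytic on a neighbourhood of the closed unit disk is a weighting
scheme if each takes the value `1` at `1` and has non-negative (real) derivatives of all orders
at `0`, and the net converges to `0` pointwise on the open unit disk. The functions are total on
`ℂ`, but only their values near the closed unit disk are relevant. -/
structure IsWeightingScheme {J : Type*} [Preorder J] (f : J → ℂ → ℂ) : Prop where
  analytic : ∀ j, AnalyticOnNhd ℂ (f j) (Metric.closedBall 0 1)
  map_one : ∀ j, f j 1 = 1
  deriv_nonneg : ∀ j, ∀ k : ℕ, 0 ≤ (iteratedDeriv k (f j) 0).re ∧ (iteratedDeriv k (f j) 0).im = 0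
  tendsto_zero : ∀ z : ℂ, ‖z‖ < 1 → Filter.Tendsto (fun j => ‖f j z‖) Filter.atTop (nhds 0)

/-- `S = f(T)` in the sense of the analytic functional calculus: `S` is the contour integral
`(2πi)⁻¹ ∮ f(z) (z - T)⁻¹ dz` over a circle that is centred at `0` and has the spectrum of `T` in
its interior, where `f` is analytic near the closed disk bounded by this circle. By the Cauchy
theorem the integral does not depend on the radius of the circle. -/
def IsAnalyticCalculus {E : Type*} [NormedAddCommGroup E] [NormedSpace ℂ E]
    (T : E →L[ℂ] E) (f : ℂ → ℂ) (S : E →L[ℂ] E) : Prop :=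
  ∃ R : ℝ, spectralRadius ℂ T < ENNReal.ofReal R ∧
    AnalyticOnNhd ℂ f (Metric.closedBall 0 R) ∧
    S = (2 * Real.pi * Complex.I : ℂ)⁻¹ • ∮ z in C(0, R), f z • resolvent T z

/-- An operator `T` (of spectral radius `1`) is (WS)-bounded if there is a weighting scheme
`(f_j)`, indexed by a non-empty directed set, such that the operators `f_j(T)` are bounded in
operator norm. -/
def IsWSBounded {E : Type*} [NormedAddCommGroup E] [NormedSpace ℂ E]
    (T : E →L[ℂ] E) : Prop :=
  ∃ (J : Type w) (_ : Preorder J) (_ : IsDirectedOrder J) (_ : Nonempty J) (f : J → ℂ → ℂ),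
    IsWeightingScheme f ∧
      ∃ C : ℝ, ∀ j, ∃ S : E →L[ℂ] E, IsAnalyticCalculus T (f j) S ∧ ‖S‖ ≤ C

/-! Let `l` be a unimodular spectral value and suppose that `l ^ k` lies in the resolvent set. Since
`l` is a boundary point of the spectrum, there are unit vectors `x` with `T x - l • x` as small as
desired (`exists_approximate_eigenvector`).

Kakutani's theorem turns `x` into a complex continuous function, so that `u = |x| (x/|x|)^k` makes
sense and `|u| = |x|`. On the unit circle `z^k - 1 - k(z - 1)` is bounded by `C|z - 1|^2 = 2C(1 - Re
z)`, which is affine in `z`. The resulting inequalities are therefore real-linear in `u`, `x` and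
`|x|`, and survive the application of a positive operator. This gives `|Tu - l^k u| ≤ D(T|x| - |x| +
2|Tx - lx|)` (`exists_isModulus_zpow`).

The resolvent at `l ^ k` is close to a polynomial in `T` with coefficients of modulus at most `1`
(`exists_sum_pow_near_resolvent`). Recovering `u` from `Tu - l^k u` this way and telescoping yields
`|x| ≤ D(T^M|x| - |x| + small) + small` (`IsPositive.exists_modulus_le`).

Finally `f_j(T) = ∑ a_{j,i} T^i`, where the weights are non-negative, sum to `1` and escape to
infinity. Take approximate eigenvectors `x_n` with errors tending to `0` and positive functionals
`φ_n` norming `|x_n|`. A subsequential limit `β(i)` of `φ_n(T^i |x_n|)` is increasing with `β(0) =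
1`, and it is bounded because its weighted means are. So `β` converges, its weighted means are
asymptotically invariant under the shift by `M`, and the inequality collapses to `1 ≤ 3/4`
(`false_of_weighted_means`). -/

/-! ### Supremum preserving sublinear functionals and lattice homomorphisms. -/

/-- Sublinear functionals on a vector lattice that preserve binary suprema. -/
structure IsSupSublinear {V : Type*} [AddCommGroup V] [Lattice V] [Module ℝ V]
    (p : V → ℝ) : Prop where
  add_le : ∀ v w, p (v + w) ≤ p v + p w
  smul : ∀ t : ℝ, 0 < t → ∀ v, p (t • v) = t * p v
  sup : ∀ v w, p (v ⊔ w) = max (p v) (p w)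

namespace IsSupSublinear

variable {V : Type*} [AddCommGroup V] [Lattice V] [Module ℝ V] {p : V → ℝ}

theorem zero (hp : IsSupSublinear p) : p 0 = 0 := by
  have := hp.smul 2 (by norm_num) 0
  rw [smul_zero] at this
  linarith

theorem neg_le (hp : IsSupSublinear p) (v : V) : -p (-v) ≤ p v := by
  have := hp.add_le v (-v)
  rw [add_neg_cancel, hp.zero] at this
  linarith

theorem monotone (hp : IsSupSublinear p) {v w : V} (h : v ≤ w) : p v ≤ p w := by
  have := hp.sup v w
  rw [sup_eq_right.2 h] at this
  rw [this]
  exact le_max_left _ _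

theorem smul_of_nonneg (hp : IsSupSublinear p) {t : ℝ} (ht : 0 ≤ t) (v : V) :
    p (t • v) = t * p v := by
  rcases ht.eq_or_lt with rfl | ht
  · simp [hp.zero]
  · exact hp.smul t ht v

/-- Along a chain the pointwise infimum is a limit: two members chosen at different points have a
common lower member, which transfers subadditivity and the supremum rule. The minorant `b` keeps the
real infima meaningful. This is the chain condition for Zorn's lemma. -/
theorem iInf_of_isChain {c : Set (V → ℝ)} (hne : c.Nonempty) (hc : IsChain (· ≤ ·) c)
    (hcp : ∀ p ∈ c, IsSupSublinear p) (b : V → ℝ) (hb : ∀ p ∈ c, ∀ v, b v ≤ p v) :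
    IsSupSublinear fun v => ⨅ p : c, (p : V → ℝ) v := by
  have : Nonempty c := hne.to_subtype
  have bdd : ∀ v, BddBelow (Set.range fun p : c => (p : V → ℝ) v) := fun v =>
    ⟨b v, by rintro _ ⟨p, rfl⟩; exact hb p p.2 v⟩
  have lower : ∀ p q : c, ∃ r : c, (r : V → ℝ) ≤ p ∧ (r : V → ℝ) ≤ q := fun p q => by
    rcases hc.total p.2 q.2 with h | h
    · exact ⟨p, le_rfl, h⟩
    · exact ⟨q, h, le_rfl⟩
  have smul_le : ∀ t : ℝ, 0 < t → ∀ v,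
      (⨅ p : c, (p : V → ℝ) (t • v)) ≤ t * ⨅ p : c, (p : V → ℝ) v := fun t ht v => by
    rw [Real.mul_iInf_of_nonneg ht.le]
    exact ciInf_mono (bdd _) fun p => ((hcp p p.2).smul t ht v).le
  refine ⟨fun v w => ?_, fun t ht v => (smul_le t ht v).antisymm ?_, fun v w => le_antisymm ?_ ?_⟩
  · refine le_ciInf_add_ciInf fun p q => ?_
    obtain ⟨r, hp, hq⟩ := lower p q
    exact (ciInf_le (bdd _) r).trans (((hcp r r.2).add_le v w).trans (add_le_add (hp v) (hq w)))
  · have := smul_le t⁻¹ (inv_pos.2 ht) (t • v)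
    rw [smul_smul, inv_mul_cancel₀ ht.ne', one_smul] at this
    calc t * ⨅ p : c, (p : V → ℝ) v ≤ t * (t⁻¹ * ⨅ p : c, (p : V → ℝ) (t • v)) := by gcongr
      _ = _ := by field_simp
  · by_contra! h
    obtain ⟨h1, h2⟩ := max_lt_iff.1 h
    obtain ⟨p, hp⟩ := exists_lt_of_ciInf_lt h1
    obtain ⟨q, hq⟩ := exists_lt_of_ciInf_lt h2
    obtain ⟨r, hrp, hrq⟩ := lower p q
    have := ciInf_le (bdd (v ⊔ w)) r
    rw [(hcp r r.2).sup] at this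
    exact absurd this (not_le.2 (max_lt ((hrp v).trans_lt hp) ((hrq w).trans_lt hq)))
  · exact max_le (ciInf_mono (bdd _) fun p => (hcp p p.2).monotone le_sup_left)
      (ciInf_mono (bdd _) fun p => (hcp p p.2).monotone le_sup_right)

/-- The one-sided directional limit of a sublinear functional. -/
noncomputable def direction (p : V → ℝ) (v₀ v : V) : ℝ :=
  ⨅ s : {s : ℝ // 0 ≤ s}, p (v + (s : ℝ) • v₀) - s * p v₀

theorem bddBelow_direction (hp : IsSupSublinear p) (v₀ v : V) :
    BddBelow (Set.range fun s : {s : ℝ // 0 ≤ s} => p (v + (s : ℝ) • v₀) - s * p v₀) := by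
  refine ⟨-p (-v), ?_⟩
  rintro _ ⟨s, rfl⟩
  have := hp.add_le (v + (s : ℝ) • v₀) (-v)
  rw [add_neg_cancel_comm, hp.smul_of_nonneg s.2] at this
  dsimp only
  linarith

theorem direction_le (hp : IsSupSublinear p) (v₀ v : V) {s : ℝ} (hs : 0 ≤ s) :
    direction p v₀ v ≤ p (v + s • v₀) - s * p v₀ :=
  ciInf_le (bddBelow_direction hp v₀ v) ⟨s, hs⟩

theorem direction_antitone (hp : IsSupSublinear p) (v₀ v : V) {s t : ℝ} (hst : s ≤ t) :
    p (v + t • v₀) - t * p v₀ ≤ p (v + s • v₀) - s * p v₀ := by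
  have h := hp.add_le (v + s • v₀) ((t - s) • v₀)
  rw [hp.smul_of_nonneg (sub_nonneg.2 hst), add_assoc, ← add_smul, add_sub_cancel] at h
  linarith

/-- Translation by `s • v₀` commutes with suprema, and the expression under the infimum decreases in
`s`, so two values of `s` can be replaced by the larger one. -/
theorem direction_isSupSublinear [IsOrderedAddMonoid V] (hp : IsSupSublinear p) (v₀ : V) :
    IsSupSublinear (direction p v₀) := by
  have : Nonempty {s : ℝ // 0 ≤ s} := ⟨⟨0, le_rfl⟩⟩
  have smul_le : ∀ t : ℝ, 0 < t → ∀ v, direction p v₀ (t • v) ≤ t * direction p v₀ v :=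
    fun t ht v => by
    unfold direction
    rw [Real.mul_iInf_of_nonneg ht.le]
    refine le_ciInf fun s => ?_
    have := direction_le hp v₀ (t • v) (mul_nonneg ht.le s.2)
    rw [mul_smul, ← smul_add, hp.smul t ht] at this
    unfold direction at this
    linarith
  have mono : ∀ v w, v ≤ w → direction p v₀ v ≤ direction p v₀ w := fun v w h =>
    ciInf_mono (bddBelow_direction hp v₀ v) fun s =>
      sub_le_sub_right (hp.monotone (add_le_add_left h _)) _
  refine ⟨fun v w => ?_, fun t ht v => (smul_le t ht v).antisymm ?_, fun v w => le_antisymm ?_ ?_⟩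
  · refine le_ciInf_add_ciInf fun s t => ?_
    have h1 := direction_le hp v₀ (v + w) (add_nonneg s.2 t.2)
    have h2 := hp.add_le (v + (s : ℝ) • v₀) (w + (t : ℝ) • v₀)
    rw [show v + (s : ℝ) • v₀ + (w + (t : ℝ) • v₀) = v + w + ((s : ℝ) + t) • v₀ by
      rw [add_smul]; abel] at h2
    linarith
  · have := smul_le t⁻¹ (inv_pos.2 ht) (t • v)
    rw [smul_smul, inv_mul_cancel₀ ht.ne', one_smul] at this
    calc t * direction p v₀ v ≤ t * (t⁻¹ * direction p v₀ (t • v)) := by gcongr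
      _ = _ := by field_simp
  · by_contra! h
    obtain ⟨h1, h2⟩ := max_lt_iff.1 h
    obtain ⟨s, hs⟩ := exists_lt_of_ciInf_lt h1
    obtain ⟨t, ht⟩ := exists_lt_of_ciInf_lt h2
    have h3 := direction_le hp v₀ (v ⊔ w) (s.2.trans (le_max_left (s : ℝ) t))
    rw [sup_add, hp.sup, ← max_sub_sub_right] at h3
    exact absurd h3 (not_le.2 (max_lt
      ((direction_antitone hp v₀ v (le_max_left _ _)).trans_lt hs)
      ((direction_antitone hp v₀ w (le_max_right _ _)).trans_lt ht)))
  · exact max_le (mono _ _ le_sup_left) (mono _ _ le_sup_right)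

theorem direction_le_self (hp : IsSupSublinear p) (v₀ v : V) : direction p v₀ v ≤ p v := by
  simpa using direction_le hp v₀ v le_rfl

theorem direction_neg_le (hp : IsSupSublinear p) (v₀ : V) : direction p v₀ (-v₀) ≤ -p v₀ := by
  simpa [hp.zero] using direction_le hp v₀ (-v₀) zero_le_one

/-- Every supremum preserving sublinear functional dominates a lattice homomorphism which agrees
with it at a given point. -/
theorem exists_latticeHom [IsOrderedAddMonoid V] (hp : IsSupSublinear p) (v₀ : V) :
    ∃ χ : V →ₗ[ℝ] ℝ, (∀ v w, χ (v ⊔ w) = max (χ v) (χ w)) ∧ (∀ v, χ v ≤ p v) ∧ χ v₀ = p v₀ := by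
  -- Starting Zorn below `direction p v₀` instead of `p` forces every minorant `r` to satisfy `r
  -- (-v₀) ≤ -p v₀`, which gives the equality at `v₀` once `r` is linear.
  set q := direction p v₀ with hq
  have hqs : IsSupSublinear q := direction_isSupSublinear hp v₀
  let S : Set (V → ℝ)ᵒᵈ := {r | IsSupSublinear (OrderDual.ofDual r) ∧ OrderDual.ofDual r ≤ q}
  obtain ⟨m, hmq, hm⟩ := zorn_le_nonempty₀ S (by
    intro c hcS hc y hy
    have hlow : ∀ r ∈ c, ∀ v, -q (-v) ≤ OrderDual.ofDual r v := fun r hr v =>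
      (neg_le_neg ((hcS hr).2 (-v))).trans ((hcS hr).1.neg_le v)
    refine ⟨OrderDual.toDual fun v => ⨅ r : c, OrderDual.ofDual (r : (V → ℝ)ᵒᵈ) v, ⟨?_, ?_⟩, ?_⟩
    · exact iInf_of_isChain (c := c) ⟨y, hy⟩ hc.symm (fun r hr => (hcS hr).1) _ hlow
    · intro v
      exact (ciInf_le ⟨_, by rintro _ ⟨r, rfl⟩; exact hlow r r.2 v⟩ (⟨y, hy⟩ : c)).trans
        ((hcS hy).2 v)
    · intro r hr v
      exact ciInf_le (f := fun r : c => OrderDual.ofDual (r : (V → ℝ)ᵒᵈ) v)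
        ⟨_, by rintro _ ⟨r, rfl⟩; exact hlow r r.2 v⟩ (⟨r, hr⟩ : c))
    (OrderDual.toDual q) ⟨hqs, le_rfl⟩
  set r : V → ℝ := OrderDual.ofDual m with hr
  have hrs : IsSupSublinear r := hm.prop.1
  have hrq : r ≤ q := hm.prop.2
  -- By minimality `r` coincides with its own directional limit at every `v`; oddness follows, and
  -- an odd sublinear functional is linear.
  have neg : ∀ v, r (-v) = -r v := fun v => by
    have hle : r ≤ direction r v := hm.2 (y := OrderDual.toDual (direction r v))
      ⟨direction_isSupSublinear hrs v, fun w => (direction_le_self hrs v w).trans (hrq w)⟩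
      (fun w => direction_le_self hrs v w)
    have h1 := (hle (-v)).trans (direction_neg_le hrs v)
    have h2 := hrs.neg_le v
    linarith
  have add : ∀ v w, r (v + w) = r v + r w := fun v w => by
    refine (hrs.add_le v w).antisymm ?_
    have := hrs.add_le (-v) (-w)
    rw [← neg_add, neg, neg, neg] at this
    linarith
  refine ⟨{ toFun := r, map_add' := add, map_smul' := fun t v => ?_ }, hrs.sup,
    fun v => (hrq v).trans (direction_le_self hp v₀ v), ?_⟩
  · rcases le_total 0 t with ht | ht
    · exact hrs.smul_of_nonneg ht v
    · have := hrs.smul_of_nonneg (neg_nonneg.2 ht) v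
      rw [neg_smul, neg] at this
      simp only [RingHom.id_apply, smul_eq_mul]
      linarith
  · refine ((hrq v₀).trans (direction_le_self hp v₀ v₀)).antisymm ?_
    have := (hrq (-v₀)).trans (direction_neg_le hp v₀)
    rw [neg] at this
    change p v₀ ≤ r v₀
    linarith

end IsSupSublinear

/-! ### Order units and their gauge. -/

section OrderUnit

variable {V : Type*} [AddCommGroup V] [Lattice V] [IsOrderedAddMonoid V] [Module ℝ V]
  [IsOrderedModule ℝ V]

theorem smul_le_smul_of_le_of_nonneg {e : V} (he : 0 ≤ e) {s t : ℝ} (h : s ≤ t) :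
    s • e ≤ t • e := smul_le_smul_of_nonneg_right h he

theorem bddBelow_setOf_le_smul {e : V} (he : 0 < e) (hu : ∀ v : V, ∃ t : ℝ, v ≤ t • e) (v : V) :
    BddBelow {t : ℝ | v ≤ t • e} := by
  obtain ⟨n, hn⟩ := hu (-v)
  refine ⟨-n, fun t ht => ?_⟩
  by_contra! hlt
  have h0 : 0 ≤ (t + n) • e := by
    have := add_le_add ht hn
    rwa [add_neg_cancel, ← add_smul] at this
  have h1 : (-(t + n))⁻¹ • ((t + n) • e) = -e := by
    rw [smul_smul, inv_neg, neg_mul, inv_mul_cancel₀ (by linarith), neg_smul, one_smul]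
  have h2 : 0 ≤ -e := by
    rw [← h1]
    exact smul_nonneg (inv_nonneg.2 (by linarith)) h0
  exact he.not_ge (neg_nonneg.1 h2)

/-- A multiple of `e` dominates `v ⊔ w` exactly when it dominates both, so the gauge of `e` turns
suprema into maxima. -/
theorem sInf_le_smul_isSupSublinear {e : V} (he : 0 < e) (hu : ∀ v : V, ∃ t : ℝ, v ≤ t • e) :
    IsSupSublinear fun v : V => sInf {t : ℝ | v ≤ t • e} := by
  have bdd := bddBelow_setOf_le_smul he hu
  have lt_mem : ∀ {v : V} {t : ℝ}, sInf {t : ℝ | v ≤ t • e} < t → v ≤ t • e := fun {v t} h => by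
    obtain ⟨s, hs, hst⟩ := exists_lt_of_csInf_lt (hu v) h
    exact le_trans hs (smul_le_smul_of_le_of_nonneg he.le hst.le)
  have smul_le : ∀ t : ℝ, 0 < t → ∀ v : V,
      sInf {s : ℝ | t • v ≤ s • e} ≤ t * sInf {s : ℝ | v ≤ s • e} := fun t ht v => by
    refine le_of_forall_pos_le_add fun ε hε => ?_
    refine csInf_le (bdd _) ?_
    have := smul_le_smul_of_nonneg_left
      (lt_mem (v := v) (lt_add_of_pos_right _ (div_pos hε ht))) ht.le
    rwa [smul_smul, mul_add, mul_div_cancel₀ _ ht.ne'] at this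
  refine ⟨fun v w => ?_, fun t ht v => (smul_le t ht v).antisymm ?_, fun v w => le_antisymm ?_ ?_⟩
  · refine le_of_forall_pos_le_add fun ε hε => csInf_le (bdd _) ?_
    have := add_le_add (lt_mem (v := v) (lt_add_of_pos_right _ (half_pos hε)))
      (lt_mem (v := w) (lt_add_of_pos_right _ (half_pos hε)))
    rw [← add_smul] at this
    refine this.trans (smul_le_smul_of_le_of_nonneg he.le (by linarith))
  · have := smul_le t⁻¹ (inv_pos.2 ht) (t • v)
    rw [smul_smul, inv_mul_cancel₀ ht.ne', one_smul] at this
    calc t * sInf {s : ℝ | v ≤ s • e} ≤ t * (t⁻¹ * sInf {s : ℝ | t • v ≤ s • e}) := by gcongr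
      _ = _ := by field_simp
  · refine le_of_forall_gt_imp_ge_of_dense fun s hs => csInf_le (bdd _) ?_
    exact sup_le (lt_mem ((le_max_left _ _).trans_lt hs)) (lt_mem ((le_max_right _ _).trans_lt hs))
  · exact max_le (csInf_le_csInf (bdd _) (hu _) fun t ht => le_sup_left.trans ht)
      (csInf_le_csInf (bdd _) (hu _) fun t ht => le_sup_right.trans ht)

/-- In an Archimedean vector lattice with order unit `e`, the normalized lattice homomorphisms
determine the order. -/
theorem le_smul_of_forall_latticeHom_le {e : V} (he : 0 < e) (hu : ∀ v : V, ∃ t : ℝ, v ≤ t • e)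
    (harch : ∀ (v : V) (t : ℝ), (∀ s > t, v ≤ s • e) → v ≤ t • e) (v : V) (t : ℝ)
    (h : ∀ χ : V →ₗ[ℝ] ℝ, (∀ v w, χ (v ⊔ w) = max (χ v) (χ w)) → χ e = 1 → χ v ≤ t) :
    v ≤ t • e := by
  have bdd := bddBelow_setOf_le_smul he hu
  -- The homomorphism attains the gauge at `v`, so a bound on `χ v` bounds the gauge. Domination at
  -- `e` and `-e` normalizes it.
  obtain ⟨χ, hsup, hle, hv⟩ := (sInf_le_smul_isSupSublinear he hu).exists_latticeHom v
  have h1 : χ e ≤ 1 := (hle e).trans (csInf_le (bdd _) (by simp))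
  have h2 : χ (-e) ≤ -1 := (hle (-e)).trans (csInf_le (bdd _) (by simp))
  rw [map_neg] at h2
  have h3 := h χ hsup (by linarith)
  rw [hv] at h3
  refine harch v t fun s hs => ?_
  obtain ⟨r, hr, hrs⟩ := exists_lt_of_csInf_lt (hu v) (h3.trans_lt hs)
  exact le_trans hr (smul_le_smul_of_le_of_nonneg he.le hrs.le)

end OrderUnit

/-! ### Kakutani representation of principal ideals. -/

section Kakutani

variable {X : Type*} [NormedAddCommGroup X] [Lattice X] [IsOrderedAddMonoid X]
  [NormedSpace ℝ X] [IsOrderedModule ℝ X]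

/-- The ideal of a vector lattice that is generated by a positive element. -/
def principalIdeal (e : X) (he : 0 ≤ e) : Submodule ℝ X where
  carrier := {v | ∃ t : ℝ, -(t • e) ≤ v ∧ v ≤ t • e}
  zero_mem' := ⟨1, by simpa using he, by simpa using he⟩
  add_mem' := by
    rintro v w ⟨t, h1, h2⟩ ⟨s, h3, h4⟩
    refine ⟨t + s, ?_, ?_⟩
    · rw [add_smul, neg_add]; exact add_le_add h1 h3
    · rw [add_smul]; exact add_le_add h2 h4
  smul_mem' := by
    rintro c v ⟨t, h1, h2⟩
    rcases le_total 0 c with hc | hc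
    · refine ⟨c * t, ?_, ?_⟩
      · rw [mul_smul, ← smul_neg]; exact smul_le_smul_of_nonneg_left h1 hc
      · rw [mul_smul]; exact smul_le_smul_of_nonneg_left h2 hc
    · have hc' : 0 ≤ -c := neg_nonneg.2 hc
      refine ⟨-c * t, ?_, ?_⟩
      · have := smul_le_smul_of_nonneg_left h2 hc'
        rw [mul_smul]
        simpa using neg_le_neg this
      · have := smul_le_smul_of_nonneg_left h1 hc'
        rw [mul_smul, ← neg_le_neg_iff]
        simpa using this

theorem self_mem_principalIdeal {e : X} (he : 0 ≤ e) : e ∈ principalIdeal e he :=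
  ⟨1, by simpa using (neg_nonpos.2 he).trans he, by simp⟩

instance principalIdeal.lattice (e : X) (he : 0 ≤ e) : Lattice (principalIdeal e he) :=
  Subtype.lattice
    (by
      rintro v w ⟨t, h1, h2⟩ ⟨s, h3, h4⟩
      exact ⟨max t s,
        (neg_le_neg (smul_le_smul_of_le_of_nonneg he (le_max_left t s))).trans
          (h1.trans le_sup_left),
        sup_le (h2.trans (smul_le_smul_of_le_of_nonneg he (le_max_left t s)))
          (h4.trans (smul_le_smul_of_le_of_nonneg he (le_max_right t s)))⟩)
    (by
      rintro v w ⟨t, h1, h2⟩ ⟨s, h3, h4⟩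
      exact ⟨max t s,
        le_inf ((neg_le_neg (smul_le_smul_of_le_of_nonneg he (le_max_left t s))).trans h1)
          ((neg_le_neg (smul_le_smul_of_le_of_nonneg he (le_max_right t s))).trans h3),
        inf_le_left.trans (h2.trans (smul_le_smul_of_le_of_nonneg he (le_max_left t s)))⟩)

instance principalIdeal.isOrderedAddMonoid (e : X) (he : 0 ≤ e) :
    IsOrderedAddMonoid (principalIdeal e he) where
  add_le_add_left _ _ h c := add_le_add_left (Subtype.coe_le_coe.2 h) (c : X)

instance principalIdeal.isOrderedModule (e : X) (he : 0 ≤ e) :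
    IsOrderedModule ℝ (principalIdeal e he) where
  smul_le_smul_of_nonneg_left _ hc _ _ h :=
    smul_le_smul_of_nonneg_left (α := ℝ) (β := X) (Subtype.coe_le_coe.2 h) hc
  smul_le_smul_of_nonneg_right b hb _ _ h :=
    smul_le_smul_of_nonneg_right (α := ℝ) (β := X) h (Subtype.coe_le_coe.2 hb : (0 : X) ≤ b)

/-- The normalized lattice homomorphisms on a vector lattice with distinguished element `e`. -/
def latticeCharacters {V : Type*} [AddCommGroup V] [Lattice V] [Module ℝ V] (e : V) :
    Set (V → ℝ) :=
  {χ | (∀ v w, χ (v + w) = χ v + χ w) ∧ (∀ (t : ℝ) v, χ (t • v) = t * χ v) ∧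
    (∀ v w, χ (v ⊔ w) = max (χ v) (χ w)) ∧ χ e = 1}

/-- The order unit confines each value `χ v` to a fixed interval, and the defining identities are
closed under pointwise convergence; Tychonoff's theorem does the rest. -/
theorem isCompact_latticeCharacters {V : Type*} [AddCommGroup V] [Lattice V]
    [Module ℝ V] {e : V}
    (hu : ∀ v : V, ∃ t : ℝ, -(t • e) ≤ v ∧ v ≤ t • e) : IsCompact (latticeCharacters e) := by
  choose b hb1 hb2 using hu
  refine (isCompact_univ_pi fun v => isCompact_Icc (a := -b v) (b := b v)).of_isClosed_subset ?_ ?_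
  · refine IsClosed.inter ?_ (IsClosed.inter ?_ (IsClosed.inter ?_ ?_))
    · change IsClosed {χ : V → ℝ | ∀ v w, χ (v + w) = χ v + χ w}
      simp only [Set.ofPred_forall]
      exact isClosed_iInter fun v => isClosed_iInter fun w =>
        isClosed_eq (by fun_prop) (by fun_prop)
    · change IsClosed {χ : V → ℝ | ∀ (t : ℝ) v, χ (t • v) = t * χ v}
      simp only [Set.ofPred_forall]
      exact isClosed_iInter fun t => isClosed_iInter fun v =>
        isClosed_eq (by fun_prop) (by fun_prop)
    · change IsClosed {χ : V → ℝ | ∀ v w, χ (v ⊔ w) = max (χ v) (χ w)}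
      simp only [Set.ofPred_forall]
      exact isClosed_iInter fun v => isClosed_iInter fun w =>
        isClosed_eq (by fun_prop) ((continuous_apply v).max (continuous_apply w))
    · exact isClosed_eq (by fun_prop) (by fun_prop)
  · rintro χ ⟨-, hs, hsup, he⟩ v -
    have mono : ∀ v w, v ≤ w → χ v ≤ χ w := fun v w h => by
      have := hsup v w
      rw [sup_eq_right.2 h] at this
      rw [this]
      exact le_max_left _ _
    have h1 := mono _ _ (hb1 v)
    have h2 := mono _ _ (hb2 v)
    rw [← neg_smul, hs, he, mul_one] at h1
    rw [hs, he, mul_one] at h2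
    exact ⟨h1, h2⟩

/-- Evaluation of lattice characters. -/
def latticeGelfand {V : Type*} [AddCommGroup V] [Lattice V] [Module ℝ V] (e : V) :
    V →ₗ[ℝ] C(latticeCharacters e, ℝ) where
  toFun v := ⟨fun χ => (χ : V → ℝ) v, (continuous_apply v).comp continuous_subtype_val⟩
  map_add' v w := by ext χ; exact χ.2.1 v w
  map_smul' t v := by ext χ; exact χ.2.2.1 t v

theorem latticeGelfand_apply {V : Type*} [AddCommGroup V] [Lattice V] [Module ℝ V] (e v : V)
    (χ : latticeCharacters e) : latticeGelfand e v χ = (χ : V → ℝ) v := rfl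

/-- Lattice form of Stone–Weierstrass: the image is a sublattice which interpolates any two values
at two points, because distinct characters are separated and `e` supplies the constants. -/
theorem latticeGelfand_denseRange {V : Type*} [AddCommGroup V] [Lattice V] [IsOrderedAddMonoid V]
    [Module ℝ V] {e : V} [CompactSpace (latticeCharacters e)] :
    closure (Set.range (latticeGelfand e)) = ⊤ := by
  have hsup : ∀ v w, latticeGelfand e v ⊔ latticeGelfand e w = latticeGelfand e (v ⊔ w) :=
    fun v w => by ext χ; exact (χ.2.2.2.1 v w).symm
  refine ContinuousMap.sublattice_closure_eq_top _ (Set.range_nonempty _) ?_ ?_ ?_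
  · rintro _ ⟨v, rfl⟩ _ ⟨w, rfl⟩
    refine ⟨v ⊓ w, ?_⟩
    have h1 : v ⊓ w = v + w - v ⊔ w := by rw [← inf_add_sup v w]; abel
    rw [h1, map_sub, map_add, ← hsup]
    ext χ
    have := min_add_max (latticeGelfand e v χ) (latticeGelfand e w χ)
    simp only [ContinuousMap.sub_apply, ContinuousMap.add_apply, ContinuousMap.sup_apply,
      ContinuousMap.inf_apply]
    linarith
  · rintro _ ⟨v, rfl⟩ _ ⟨w, rfl⟩
    exact ⟨v ⊔ w, (hsup v w).symm⟩
  · intro f χ ω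
    by_cases h : χ = ω
    · subst h
      refine ⟨_, ⟨f χ • e, rfl⟩, ?_⟩
      have : latticeGelfand e (f χ • e) χ = f χ := by
        rw [latticeGelfand_apply, χ.2.2.1, χ.2.2.2.2, mul_one]
      exact ⟨this, this⟩
    · obtain ⟨v, hv⟩ : ∃ v, (χ : V → ℝ) v ≠ (ω : V → ℝ) v := by
        by_contra! h'
        exact h (Subtype.ext (funext h'))
      have hv' : (χ : V → ℝ) v - (ω : V → ℝ) v ≠ 0 := sub_ne_zero.2 hv
      set α := (f χ - f ω) / ((χ : V → ℝ) v - (ω : V → ℝ) v) with hα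
      refine ⟨_, ⟨α • v + (f χ - α * (χ : V → ℝ) v) • e, rfl⟩, ?_, ?_⟩
      · rw [latticeGelfand_apply, χ.2.1, χ.2.2.1, χ.2.2.1, χ.2.2.2.2]
        ring
      · rw [latticeGelfand_apply, ω.2.1, ω.2.2.1, ω.2.2.1, ω.2.2.2.2]
        have : α * ((χ : V → ℝ) v - (ω : V → ℝ) v) = f χ - f ω := div_mul_cancel₀ _ hv'
        linarith

theorem le_smul_of_forall_gt {X : Type*} [NormedAddCommGroup X] [Lattice X]
    [IsOrderedAddMonoid X] [NormedSpace ℝ X] [HasSolidNorm X] {e v : X} {t : ℝ} (h : ∀ s > t, v ≤ s • e) : v ≤ t • e := by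
  have h1 : Filter.Tendsto (fun s : ℝ => s • e) (nhdsWithin t (Set.Ioi t)) (nhds (t • e)) :=
    ((continuous_id.smul continuous_const).tendsto t).mono_left nhdsWithin_le_nhds
  exact ge_of_tendsto h1 (Filter.eventually_of_mem self_mem_nhdsWithin fun s hs => h s hs)

theorem norm_le_of_neg_le_of_le {X : Type*} [NormedAddCommGroup X] [Lattice X]
    [IsOrderedAddMonoid X] [HasSolidNorm X] {v w : X} (h1 : -w ≤ v) (h2 : v ≤ w) : ‖v‖ ≤ ‖w‖ :=
  norm_le_norm_of_abs_le_abs (abs_le'.2 ⟨h2, neg_le.1 h1⟩ |>.trans (le_abs_self w))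

variable [HasSolidNorm X]

theorem latticeGelfand_le_iff {e : X} (he : 0 < e) (v w : principalIdeal e he.le) :
    (∀ χ, latticeGelfand ⟨e, self_mem_principalIdeal he.le⟩ v χ ≤
      latticeGelfand ⟨e, self_mem_principalIdeal he.le⟩ w χ) ↔ v ≤ w := by
  constructor
  · intro h
    have := le_smul_of_forall_latticeHom_le (V := principalIdeal e he.le)
      (e := ⟨e, self_mem_principalIdeal he.le⟩) he
      (fun v => by obtain ⟨t, -, ht⟩ := v.2; exact ⟨t, ht⟩)
      (fun v t h => le_smul_of_forall_gt (X := X) h) (v - w) 0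
      (fun χ hsup h1 => by
        have := h ⟨χ, fun v w => map_add χ v w, fun t v => map_smul χ t v, hsup, h1⟩
        simp only [latticeGelfand_apply] at this
        rw [map_sub]
        linarith)
    rwa [zero_smul, sub_nonpos] at this
  · intro h χ
    have := χ.2.2.2.1 v w
    rw [sup_eq_right.2 h] at this
    rw [latticeGelfand_apply, latticeGelfand_apply, this]
    exact le_max_left _ _

/-- Uniform approximation of `G` at rate `2⁻ⁿ` becomes, through `latticeGelfand_le_iff`, order
bounds by multiples of `e`, hence a Cauchy sequence in the norm of `X`. Order bounds pass to the
limit, so it stays in the ideal and represents `G`. -/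
theorem latticeGelfand_surjective [CompleteSpace X] {e : X} (he : 0 < e) :
    Function.Surjective (latticeGelfand
      (⟨e, self_mem_principalIdeal he.le⟩ : principalIdeal e he.le)) := by
  set u : principalIdeal e he.le := ⟨e, self_mem_principalIdeal he.le⟩ with hu
  have : CompactSpace (latticeCharacters u) :=
    isCompact_iff_compactSpace.1 (isCompact_latticeCharacters fun v => v.2)
  intro G
  have hδ : ∀ n : ℕ, (0 : ℝ) < (1 / 2) ^ n := fun n => by positivity
  have key : ∀ n : ℕ, ∃ v : principalIdeal e he.le,
      ∀ χ, |latticeGelfand u v χ - G χ| ≤ (1 / 2) ^ n := fun n => by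
    have hG : G ∈ closure (Set.range (latticeGelfand u)) := by
      rw [latticeGelfand_denseRange]; trivial
    obtain ⟨_, ⟨v, rfl⟩, hv⟩ := Metric.mem_closure_iff.1 hG _ (hδ n)
    refine ⟨v, fun χ => ?_⟩
    rw [← Real.dist_eq, dist_comm]
    exact (ContinuousMap.dist_apply_le_dist χ).trans hv.le
  choose v hv using key
  have le_of : ∀ (a b : principalIdeal e he.le) (c : ℝ),
      (∀ χ, latticeGelfand u a χ ≤ latticeGelfand u b χ + c) → (a : X) ≤ b + c • e := by
    intro a b c h
    have : a ≤ b + c • u := by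
      rw [← latticeGelfand_le_iff he]
      intro χ
      refine (h χ).trans (le_of_eq ?_)
      rw [map_add, map_smul, ContinuousMap.add_apply, ContinuousMap.smul_apply, smul_eq_mul,
        latticeGelfand_apply u u, χ.2.2.2.2, mul_one]
    exact this
  have hpow : ∀ {n m : ℕ}, n ≤ m → ((1 : ℝ) / 2) ^ m ≤ (1 / 2) ^ n := fun h =>
    pow_le_pow_of_le_one (by norm_num) (by norm_num) h
  have hvv : ∀ N n m : ℕ, N ≤ n → N ≤ m → (v n : X) ≤ v m + (2 * (1 / 2) ^ N : ℝ) • e := by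
    intro N n m hn hm
    refine le_of _ _ _ fun χ => ?_
    have h1 := (abs_le.1 ((hv n χ).trans (hpow hn))).2
    have h2 := (abs_le.1 ((hv m χ).trans (hpow hm))).1
    linarith
  have hcau : CauchySeq fun n => (v n : X) := by
    refine cauchySeq_of_le_tendsto_0 (fun N => 2 * (1 / 2) ^ N * ‖e‖) (fun n m N hn hm => ?_) ?_
    · have h1 := hvv N n m hn hm
      have h2 := hvv N m n hm hn
      rw [dist_eq_norm]
      have : ‖(v n : X) - v m‖ ≤ ‖(2 * (1 / 2) ^ N : ℝ) • e‖ :=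
        norm_le_of_neg_le_of_le (by rw [neg_le, neg_sub, sub_le_iff_le_add']; exact h2)
          (by rw [sub_le_iff_le_add']; exact h1)
      rwa [norm_smul, Real.norm_of_nonneg (by positivity)] at this
    · have : Filter.Tendsto (fun N : ℕ => ((1 : ℝ) / 2) ^ N) Filter.atTop (nhds 0) :=
        tendsto_pow_atTop_nhds_zero_of_lt_one (by norm_num) (by norm_num)
      simpa using (this.const_mul 2).mul_const ‖e‖
  obtain ⟨y, hy⟩ := cauchySeq_tendsto_of_complete hcau
  have h1 : ∀ N, y ≤ v N + (2 * (1 / 2) ^ N : ℝ) • e := fun N =>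
    le_of_tendsto hy (Filter.eventually_atTop.2 ⟨N, fun m hm => hvv N m N hm le_rfl⟩)
  have h2 : ∀ N, (v N : X) ≤ y + (2 * (1 / 2) ^ N : ℝ) • e := fun N =>
    ge_of_tendsto (hy.add_const _)
      (Filter.eventually_atTop.2 ⟨N, fun m hm => hvv N N m le_rfl hm⟩)
  have hmem : y ∈ principalIdeal e he.le := by
    have h3 : y - v 0 ∈ principalIdeal e he.le := by
      refine ⟨2 * (1 / 2) ^ 0, ?_, ?_⟩
      · rw [neg_le, neg_sub, sub_le_iff_le_add']; exact h2 0
      · rw [sub_le_iff_le_add']; exact h1 0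
    have := (principalIdeal e he.le).add_mem h3 (v 0).2
    rwa [sub_add_cancel] at this
  refine ⟨⟨y, hmem⟩, ?_⟩
  ext χ
  have hχu : latticeGelfand u u χ = 1 := χ.2.2.2.2
  have hbound : ∀ N : ℕ, |latticeGelfand u ⟨y, hmem⟩ χ - G χ| ≤ 3 * (1 / 2) ^ N := by
    intro N
    have h3 : ∀ χ, latticeGelfand u ⟨y, hmem⟩ χ ≤ latticeGelfand u (v N + (2 * (1 / 2) ^ N : ℝ) • u) χ :=
      (latticeGelfand_le_iff he _ _).2 (h1 N)
    have h4 : ∀ χ, latticeGelfand u (v N) χ ≤ latticeGelfand u (⟨y, hmem⟩ + (2 * (1 / 2) ^ N : ℝ) • u) χ :=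
      (latticeGelfand_le_iff he _ _).2 (h2 N)
    have h5 := h3 χ
    have h6 := h4 χ
    rw [map_add, map_smul, ContinuousMap.add_apply, ContinuousMap.smul_apply, hχu, smul_eq_mul,
      mul_one] at h5 h6
    have h7 := abs_le.1 (hv N χ)
    exact abs_le.2 ⟨by linarith, by linarith⟩
  have hlim : Filter.Tendsto (fun N : ℕ => 3 * ((1 : ℝ) / 2) ^ N) Filter.atTop (nhds 0) := by
    simpa using (tendsto_pow_atTop_nhds_zero_of_lt_one (r := (1 : ℝ) / 2)
      (by norm_num) (by norm_num)).const_mul 3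
  have := ge_of_tendsto' hlim hbound
  exact sub_eq_zero.1 (abs_nonpos_iff.1 this)

/-- **Kakutani's representation theorem**: the ideal generated by a positive element of a Banach
lattice is order isomorphic to a space of continuous functions. -/
theorem exists_continuousMap_orderEmbedding [CompleteSpace X] {e : X} (he : 0 < e) :
    ∃ (K : Set (principalIdeal e he.le → ℝ)) (_ : CompactSpace K) (Ψ : C(K, ℝ) →ₗ[ℝ] X),
      (∀ F G, Ψ F ≤ Ψ G ↔ F ≤ G) ∧ Ψ 1 = e ∧ ∀ (v : X) (t : ℝ), -(t • e) ≤ v → v ≤ t • e → ∃ F, Ψ F = v := by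
  set u : principalIdeal e he.le := ⟨e, self_mem_principalIdeal he.le⟩ with hu
  have hinj : Function.Injective (latticeGelfand u) := fun v w h =>
    ((latticeGelfand_le_iff he v w).1 fun χ => (DFunLike.congr_fun h χ).le).antisymm ((latticeGelfand_le_iff he w v).1 fun χ => (DFunLike.congr_fun h χ).ge)
  let Φ := LinearEquiv.ofBijective (latticeGelfand u) ⟨hinj, latticeGelfand_surjective he⟩
  refine ⟨latticeCharacters u,
    isCompact_iff_compactSpace.1 (isCompact_latticeCharacters fun v => v.2),
    (principalIdeal e he.le).subtype ∘ₗ Φ.symm.toLinearMap, fun F G => ?_, ?_, fun v t h1 h2 => ?_⟩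
  · have := latticeGelfand_le_iff he (Φ.symm F) (Φ.symm G)
    have hF : ∀ F, latticeGelfand u (Φ.symm F) = F := Φ.apply_symm_apply
    rw [← hu, hF, hF] at this
    exact this.symm
  · have h1 : Φ u = 1 := by ext χ; exact χ.2.2.2.2
    simp [← h1, hu]
  · exact ⟨Φ ⟨v, t, h1, h2⟩, by simp⟩

end Kakutani

/-! ### Scalar estimates for powers of the phase. -/

/-- Rotating `z` onto the positive axis attains the modulus. Modulus bounds are thereby encoded as
families of real-linear inequalities, on which a positive operator can act. -/
theorem Complex.norm_le_of_forall_re_mul_le {z : ℂ} {r : ℝ}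
    (h : ∀ α : ℂ, ‖α‖ = 1 → (α * z).re ≤ r) : ‖z‖ ≤ r := by
  by_cases hz : z = 0
  · have h1 := h 1 (by simp)
    subst hz
    simpa using h1
  · have hz' : (‖z‖ : ℂ) ≠ 0 := by simpa using hz
    have h1 := h ((starRingEnd ℂ) z / ‖z‖) (by
      rw [norm_div, RCLike.norm_conj, Complex.norm_real, norm_norm, div_self (by simpa using hz)])
    have h2 : (starRingEnd ℂ) z / ‖z‖ * z = (‖z‖ : ℂ) := by
      rw [div_mul_eq_mul_div, Complex.conj_mul', sq, mul_div_assoc, div_self hz', mul_one]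
    rwa [h2, Complex.ofReal_re] at h1

theorem exists_forall_norm_zpow_sub_le (k : ℤ) : ∃ C : ℝ, 0 ≤ C ∧
    ∀ z : ℂ, ‖z‖ = 1 → ‖z ^ k - 1 - k * (z - 1)‖ ≤ C * ‖z - 1‖ ^ 2 := by
  have ne : ∀ {z : ℂ}, ‖z‖ = 1 → z ≠ 0 := fun {z} hz => norm_ne_zero_iff.1 (by rw [hz]; simp)
  induction k using Int.induction_on with
  | zero => exact ⟨0, le_rfl, fun z hz => by simp⟩
  | succ k ih =>
    obtain ⟨C, hC, h⟩ := ih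
    refine ⟨C + k, by positivity, fun z hz => ?_⟩
    have h1 : z ^ ((k : ℤ) + 1) - 1 - ((k + 1 : ℤ) : ℂ) * (z - 1) =
        z * (z ^ (k : ℤ) - 1 - (k : ℤ) * (z - 1)) + k * (z - 1) ^ 2 := by
      rw [zpow_add_one₀ (ne hz)]; push_cast; ring
    rw [h1]
    refine (norm_add_le _ _).trans ?_
    rw [norm_mul, hz, one_mul, norm_mul, norm_pow, Complex.norm_natCast, add_mul]
    gcongr
    exact h z hz
  | pred k ih =>
    obtain ⟨C, hC, h⟩ := ih
    refine ⟨C + (k + 1), by positivity, fun z hz => ?_⟩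
    have hz0 := ne hz
    have h1 : z ^ (-(k : ℤ) - 1) - 1 - ((-k - 1 : ℤ) : ℂ) * (z - 1) =
        z⁻¹ * (z ^ (-(k : ℤ)) - 1 - (-k : ℤ) * (z - 1)) + (k + 1) * z⁻¹ * (z - 1) ^ 2 := by
      rw [zpow_sub_one₀ hz0]; push_cast; field_simp; ring
    rw [h1]
    refine (norm_add_le _ _).trans ?_
    rw [norm_mul, norm_mul, norm_mul, norm_inv, hz, inv_one, one_mul, mul_one, norm_pow, add_mul]
    gcongr
    · exact h z hz
    · exact (norm_add_le _ _).trans (by simp)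

/-- This makes the quadratic Taylor remainder of `z ^ k` affine in `z`, and so compatible with
linear operators. -/
theorem norm_sub_one_sq {z : ℂ} (hz : ‖z‖ = 1) : ‖z - 1‖ ^ 2 = 2 * (1 - z.re) := by
  have h : z.re * z.re + z.im * z.im = 1 := by
    rw [← Complex.normSq_apply, Complex.normSq_eq_norm_sq, hz]; norm_num
  rw [← Complex.normSq_eq_norm_sq, Complex.normSq_apply]
  simp only [Complex.sub_re, Complex.sub_im, Complex.one_re, Complex.one_im]
  linarith

/-- `z ↦ |z| (z / |z|) ^ k`. -/
noncomputable def phasePow (k : ℤ) (z : ℂ) : ℂ := ‖z‖ * (z / ‖z‖) ^ k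

theorem norm_phasePow (k : ℤ) (z : ℂ) : ‖phasePow k z‖ = ‖z‖ := by
  by_cases hz : z = 0
  · simp [phasePow, hz]
  · have hz' : ‖z‖ ≠ 0 := norm_ne_zero_iff.2 hz
    simp [phasePow, norm_zpow, div_self hz']

theorem continuous_phasePow (k : ℤ) : Continuous (phasePow k) := by
  refine continuous_iff_continuousAt.2 fun z => ?_
  by_cases hz : z = 0
  · subst hz
    have h0 : phasePow k 0 = 0 := by simp [phasePow]
    rw [ContinuousAt, h0, tendsto_zero_iff_norm_tendsto_zero]
    simp only [norm_phasePow]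
    simpa using (continuous_norm (E := ℂ)).tendsto 0
  · have hz' : (‖z‖ : ℂ) ≠ 0 := by simpa using hz
    have hn : ContinuousAt (fun z : ℂ => (‖z‖ : ℂ)) z := by fun_prop
    exact hn.mul ((continuousAt_id.div hn hz').zpow₀ k (Or.inl (div_ne_zero hz hz')))

/-- The Taylor estimate at `c * x / ‖x‖`, multiplied by `‖x‖`. For fixed `α` and `c` both sides are
real-linear in `x`, `‖x‖` and `phasePow k x`. -/
theorem re_phasePow_le {k : ℤ} {C : ℝ}
    (hC : ∀ z : ℂ, ‖z‖ = 1 → ‖z ^ k - 1 - k * (z - 1)‖ ≤ C * ‖z - 1‖ ^ 2)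
    {α c : ℂ} (hα : ‖α‖ = 1) (hc : ‖c‖ = 1) (x : ℂ) :
    (α * (c ^ k * phasePow k x - ‖x‖ - k * (c * x - ‖x‖))).re ≤ 2 * C * (‖x‖ - (c * x).re) := by
  by_cases hx : x = 0
  · simp [hx, phasePow]
  have hx' : (‖x‖ : ℂ) ≠ 0 := by simpa using hx
  have hx'' : ‖x‖ ≠ 0 := by simpa using hx
  set z := c * (x / ‖x‖) with hz
  have hz1 : ‖z‖ = 1 := by simp [hz, hc, div_self hx'']
  have h1 : c ^ k * phasePow k x - ‖x‖ - k * (c * x - ‖x‖) =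
      ‖x‖ * (z ^ k - 1 - k * (z - 1)) := by
    have h2 : c * x = ‖x‖ * z := by rw [hz]; field_simp
    rw [phasePow, h2, hz, mul_zpow]
    ring
  have h3 : (c * x).re = ‖x‖ * z.re := by
    have h2 : c * x = ‖x‖ * z := by rw [hz]; field_simp
    rw [h2, Complex.re_ofReal_mul]
  rw [h1, h3]
  refine (Complex.re_le_norm _).trans ?_
  rw [norm_mul, hα, one_mul, norm_mul, Complex.norm_real, norm_norm]
  calc ‖x‖ * ‖z ^ k - 1 - k * (z - 1)‖ ≤ ‖x‖ * (C * ‖z - 1‖ ^ 2) := by gcongr; exact hC z hz1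
    _ = _ := by rw [norm_sub_one_sq hz1]; ring

/-- Pointwise evaluation after the operator has acted: `U`, `l * x + ε` and `M` stand for the values
of the images of `phasePow k x`, `x` and `‖x‖`. The rotation `c` must suit the point, so `h` is
required for all `c`. -/
theorem norm_sub_phasePow_le {k : ℤ} {C : ℝ} (hC : 0 ≤ C) {U x ε l : ℂ} {M : ℝ} (hl : ‖l‖ = 1)
    (hM : ∀ c : ℂ, ‖c‖ = 1 → (c * (l * x + ε)).re ≤ M)
    (h : ∀ α c : ℂ, ‖α‖ = 1 → ‖c‖ = 1 →
      (α * (c ^ k * U - M - k * (c * (l * x + ε) - M))).re ≤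
        2 * C * (M - (c * (l * x + ε)).re)) :
    ‖U - l ^ k * phasePow k x‖ ≤ (2 * C + 1 + 2 * |k|) * (M - ‖x‖ + 2 * ‖ε‖) := by
  obtain ⟨c, hc, hcx, hcp⟩ : ∃ c : ℂ, ‖c‖ = 1 ∧ c * l * x = ‖x‖ ∧
      c ^ k * (l ^ k * phasePow k x) = ‖x‖ := by
    by_cases hx : x = 0
    · exact ⟨1, by simp, by simp [hx], by simp [hx, phasePow]⟩
    · have hx' : (‖x‖ : ℂ) ≠ 0 := by simpa using hx
      have hx'' : ‖x‖ ≠ 0 := by simpa using hx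
      have hl0 : l ≠ 0 := norm_ne_zero_iff.1 (by rw [hl]; simp)
      have h1 : (l * (x / ‖x‖))⁻¹ * l * (x / ‖x‖) = 1 := by field_simp
      refine ⟨(l * (x / ‖x‖))⁻¹, by simp [hl, div_self hx''], by field_simp, ?_⟩
      calc _ = ‖x‖ * ((l * (x / ‖x‖))⁻¹ * l * (x / ‖x‖)) ^ k := by
            rw [phasePow, mul_zpow, mul_zpow]; ring
        _ = ‖x‖ := by rw [h1, one_zpow, mul_one]
  have hck : ‖c ^ k‖ = 1 := by rw [norm_zpow, hc, one_zpow]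
  have h1 : ‖c ^ k * U - M - k * (c * (l * x + ε) - M)‖ ≤ 2 * C * (M - (c * (l * x + ε)).re) :=
    Complex.norm_le_of_forall_re_mul_le fun α hα => h α c hα hc
  have h2 : c * (l * x + ε) = ‖x‖ + c * ε := by rw [← hcx]; ring
  have hcε : ‖c * ε‖ = ‖ε‖ := by rw [norm_mul, hc, one_mul]
  have hre : -‖ε‖ ≤ (c * ε).re := by
    rw [← hcε]; exact (abs_le.1 (Complex.abs_re_le_norm _)).1
  have h3 := hM c hc
  rw [h2] at h1 h3
  rw [Complex.add_re, Complex.ofReal_re] at h1 h3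
  -- Only `M ≥ ‖x‖ - ‖ε‖` is known, so `M - ‖x‖` may be negative; the second `‖ε‖` absorbs its sign.
  have h4 : |M - ‖x‖| ≤ M - ‖x‖ + 2 * ‖ε‖ := by
    rw [abs_le]; constructor <;> linarith [norm_nonneg ε]
  have h5 : ‖(‖x‖ : ℂ) + c * ε - M‖ ≤ 2 * (M - ‖x‖ + 2 * ‖ε‖) := by
    have : (‖x‖ : ℂ) + c * ε - M = c * ε - ((M - ‖x‖ : ℝ) : ℂ) := by push_cast; ring
    rw [this]
    refine (norm_sub_le _ _).trans ?_
    rw [hcε, Complex.norm_real, Real.norm_eq_abs]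
    linarith
  have h6 : ‖U - l ^ k * phasePow k x‖ = ‖c ^ k * U - ‖x‖‖ := by
    rw [← one_mul ‖U - _‖, ← hck, ← norm_mul, mul_sub, hcp]
  have h7 : c ^ k * U - ‖x‖ = (c ^ k * U - M - k * (‖x‖ + c * ε - M)) +
      ((M - ‖x‖ : ℝ) : ℂ) + k * (‖x‖ + c * ε - M) := by push_cast; ring
  rw [h6, h7]
  refine (norm_add₃_le).trans ?_
  rw [Complex.norm_real, Real.norm_eq_abs, norm_mul, Complex.norm_intCast]
  have h8 : 2 * C * (M - (‖x‖ + (c * ε).re)) ≤ 2 * C * (M - ‖x‖ + 2 * ‖ε‖) := by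
    gcongr; linarith [norm_nonneg ε]
  have h9 : |(k : ℝ)| * ‖(‖x‖ : ℂ) + c * ε - M‖ ≤ |(k : ℝ)| * (2 * (M - ‖x‖ + 2 * ‖ε‖)) := by
    gcongr
  push_cast
  linarith

theorem Complex.cos_mul_re_add_sin_mul_im_le (z : ℂ) (θ : ℝ) :
    Real.cos θ * z.re + Real.sin θ * z.im ≤ ‖z‖ := by
  have h : Real.cos θ * z.re + Real.sin θ * z.im = (Complex.exp ((-θ : ℝ) * Complex.I) * z).re := by
    rw [Complex.mul_re, Complex.exp_ofReal_mul_I_re, Complex.exp_ofReal_mul_I_im, Real.cos_neg,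
      Real.sin_neg]
    ring
  rw [h]
  refine (Complex.re_le_norm _).trans ?_
  rw [norm_mul, Complex.norm_exp_ofReal_mul_I, one_mul]

/-- The sign appears because `x cos θ + y sin θ` is the real part of `e^{-iθ}(x + iy)`. -/
theorem Complex.exists_cos_sin_eq {α : ℂ} (hα : ‖α‖ = 1) :
    ∃ θ : ℝ, Real.cos θ = α.re ∧ -Real.sin θ = α.im := by
  refine ⟨-α.arg, ?_, ?_⟩
  · have := Complex.norm_mul_cos_arg α
    rw [hα, one_mul] at this
    rw [Real.cos_neg, this]
  · have := Complex.norm_mul_sin_arg α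
    rw [hα, one_mul] at this
    rw [Real.sin_neg, neg_neg, this]

/-! ### The modulus and the power construction on a real Banach lattice. -/

section Modulus

variable {X : Type*} [NormedAddCommGroup X] [Lattice X] [NormedSpace ℝ X]

/-- `m` is the modulus of `a + i b`. -/
def IsModulus (a b m : X) : Prop :=
  IsLUB (Set.range fun θ : ℝ => Real.cos θ • a + Real.sin θ • b) m

theorem IsModulus.re_mul_le {a b m : X} (h : IsModulus a b m) {α : ℂ} (hα : ‖α‖ = 1) :
    α.re • a - α.im • b ≤ m := by
  obtain ⟨θ, h1, h2⟩ := Complex.exists_cos_sin_eq hα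
  rw [← h1, ← h2, neg_smul, sub_neg_eq_add]
  exact h.1 ⟨θ, rfl⟩

theorem IsModulus.le {a b m n : X} (h : IsModulus a b m)
    (hn : ∀ α : ℂ, ‖α‖ = 1 → α.re • a - α.im • b ≤ n) : m ≤ n := by
  refine h.2 ?_
  rintro _ ⟨θ, rfl⟩
  have := hn (Complex.exp ((-θ : ℝ) * Complex.I)) (Complex.norm_exp_ofReal_mul_I _)
  rwa [Complex.exp_ofReal_mul_I_re, Complex.exp_ofReal_mul_I_im, Real.cos_neg, Real.sin_neg,
    neg_smul, sub_neg_eq_add] at this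

theorem isModulus_map_iff {K : Type*} [TopologicalSpace K] (Ψ : C(K, ℝ) →ₗ[ℝ] X)
    (hΨ : ∀ F G, Ψ F ≤ Ψ G ↔ F ≤ G)
    (hran : ∀ H F v, -Ψ H ≤ v → v ≤ Ψ F → ∃ G, Ψ G = v) (A B H : C(K, ℝ)) :
    IsModulus (Ψ A) (Ψ B) (Ψ H) ↔ ∀ s, H s = ‖(⟨A s, B s⟩ : ℂ)‖ := by
  constructor
  · intro h s
    refine le_antisymm ?_ ?_
    · let N : C(K, ℝ) := ⟨fun s => ‖(A s : ℂ) + B s * Complex.I‖, by fun_prop⟩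
      have hN : ∀ s, N s = ‖(⟨A s, B s⟩ : ℂ)‖ := fun s => by
        rw [Complex.mk_eq_add_mul_I]; rfl
      rw [← hN]
      have : Ψ H ≤ Ψ N := h.2 (by
        rintro _ ⟨θ, rfl⟩
        dsimp only
        rw [← map_smul, ← map_smul, ← map_add, hΨ, ContinuousMap.le_def]
        intro s
        rw [hN]
        exact Complex.cos_mul_re_add_sin_mul_im_le ⟨A s, B s⟩ θ)
      exact ContinuousMap.le_def.1 ((hΨ _ _).1 this) s
    · refine Complex.norm_le_of_forall_re_mul_le fun α hα => ?_
      have := h.re_mul_le hα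
      rw [← map_smul, ← map_smul, ← map_sub, hΨ, ContinuousMap.le_def] at this
      simpa [Complex.mul_re] using this s
  · intro h
    have ub : ∀ θ : ℝ, Real.cos θ • Ψ A + Real.sin θ • Ψ B ≤ Ψ H := fun θ => by
      rw [← map_smul, ← map_smul, ← map_add, hΨ, ContinuousMap.le_def]
      intro s
      rw [h]
      exact Complex.cos_mul_re_add_sin_mul_im_le ⟨A s, B s⟩ θ
    refine ⟨by rintro _ ⟨θ, rfl⟩; exact ub θ, fun m hm => ?_⟩
    have hm' : ∀ θ : ℝ, Real.cos θ • Ψ A + Real.sin θ • Ψ B ≤ m ⊓ Ψ H := fun θ =>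
      le_inf (hm ⟨θ, rfl⟩) (ub θ)
    -- A competing upper bound `m` need not come from a function; cutting it down by `Ψ H` puts it
    -- between two elements of the range.
    obtain ⟨G, hG⟩ := hran (-A) H (m ⊓ Ψ H)
      (by simpa using hm' 0) inf_le_right
    refine le_trans ?_ (hG.le.trans inf_le_left)
    rw [hΨ, ContinuousMap.le_def]
    intro s
    rw [h]
    refine Complex.norm_le_of_forall_re_mul_le fun α hα => ?_
    obtain ⟨θ, h1, h2⟩ := Complex.exists_cos_sin_eq hα
    have := hm' θ
    rw [← hG, ← map_smul, ← map_smul, ← map_add, hΨ, ContinuousMap.le_def] at this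
    rw [Complex.mul_re, ← h1, ← h2, neg_mul, sub_neg_eq_add]
    exact this s

variable [IsOrderedAddMonoid X]

theorem IsModulus.bounds {a b m : X} (h : IsModulus a b m) :
    -m ≤ a ∧ a ≤ m ∧ -m ≤ b ∧ b ≤ m := by
  have h1 := h.re_mul_le (α := 1) (by simp)
  have h2 := h.re_mul_le (α := -1) (by simp)
  have h3 := h.re_mul_le (α := Complex.I) (by simp)
  have h4 := h.re_mul_le (α := -Complex.I) (by simp)
  simp only [Complex.one_re, Complex.one_im, Complex.neg_re, Complex.neg_im, Complex.I_re,
    Complex.I_im, one_smul, zero_smul, neg_smul, sub_zero, zero_sub, neg_zero, neg_neg] at h1 h2 h3 h4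
  exact ⟨neg_le.1 h2, h1, neg_le.1 h3, h4⟩

variable [IsOrderedModule ℝ X]

theorem nonneg_of_neg_le_of_le {a m : X} (h1 : -m ≤ a) (h2 : a ≤ m) : 0 ≤ m := by
  have h : 0 ≤ m + m := by simpa using add_le_add (neg_le.1 h1) h2
  rw [← two_smul ℝ] at h
  have := smul_nonneg (by norm_num : (0 : ℝ) ≤ 1 / 2) h
  rwa [smul_smul, show (1 / 2 : ℝ) * 2 = 1 by norm_num, one_smul] at this

theorem IsModulus.nonneg {a b m : X} (h : IsModulus a b m) : 0 ≤ m :=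
  nonneg_of_neg_le_of_le h.bounds.1 h.bounds.2.1

/-- If `a + i b` is an approximate eigenvector of a positive operator for the unimodular value `l`,
with error `c + i d`, then there is `p + i q` with the same modulus which is an approximate
eigenvector for `l ^ k`, with error controlled by `T h - h` where `h` is the modulus. -/
theorem exists_isModulus_zpow [HasSolidNorm X] [CompleteSpace X] {k : ℤ} {C : ℝ} (hC0 : 0 ≤ C)
    (hC : ∀ z : ℂ, ‖z‖ = 1 → ‖z ^ k - 1 - k * (z - 1)‖ ≤ C * ‖z - 1‖ ^ 2)
    (T : X →ₗ[ℝ] X) (hT : ∀ x, 0 ≤ x → 0 ≤ T x) {l : ℂ} (hl : ‖l‖ = 1) {a b h c d η : X}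
    (hh : h ≠ 0) (hab : IsModulus a b h) (hcd : IsModulus c d η)
    (ha : T a = l.re • a - l.im • b + c) (hb : T b = l.im • a + l.re • b + d) :
    ∃ p q, IsModulus p q h ∧ ∀ α : ℂ, ‖α‖ = 1 →
      α.re • (T p - ((l ^ k).re • p - (l ^ k).im • q)) -
        α.im • (T q - ((l ^ k).im • p + (l ^ k).re • q)) ≤
      (2 * C + 1 + 2 * |k| : ℝ) • (T h - h + (2 : ℝ) • η) := by
  have mono : ∀ {x y}, x ≤ y → T x ≤ T y := fun {x y} hxy => by
    have := hT _ (sub_nonneg.2 hxy)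
    rwa [map_sub, sub_nonneg] at this
  have h0 := hab.nonneg
  have η0 := hcd.nonneg
  -- `T` need not preserve the ideal of `h`. This `e` dominates the moduli of the vector and of the
  -- error as well as `T h`, so all elements in play become functions on one space.
  set e := h + η + T h with he
  have hhe : h ≤ e := by rw [he, add_assoc]; exact le_add_of_nonneg_right (add_nonneg η0 (hT _ h0))
  have hηe : η ≤ e := by
    rw [he, add_comm h, add_assoc]; exact le_add_of_nonneg_right (add_nonneg h0 (hT _ h0))
  have hThe : T h ≤ e := le_add_of_nonneg_left (add_nonneg h0 η0)
  have e0 : 0 < e := (lt_of_le_of_ne h0 (Ne.symm hh)).trans_le hhe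
  obtain ⟨K, hK, Ψ, hΨ, h_one, hran⟩ := exists_continuousMap_orderEmbedding e0
  have lift : ∀ {v w}, w ≤ e → -w ≤ v → v ≤ w → ∃ F, Ψ F = v := fun {v w} hw h1 h2 =>
    hran v 1 (by rw [one_smul]; exact (neg_le_neg hw).trans h1) (by rw [one_smul]; exact h2.trans hw)
  have hran' : ∀ H F v, -Ψ H ≤ v → v ≤ Ψ F → ∃ G, Ψ G = v := by
    intro H F v h1 h2
    have hb : ∀ F : C(K, ℝ), ∀ t, ‖F‖ ≤ t → Ψ F ≤ t • e := fun F t ht => by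
      have h2 : Ψ F ≤ Ψ (t • 1) := by
        rw [hΨ, ContinuousMap.le_def]
        intro s
        simpa using (le_abs_self (F s)).trans ((F.norm_coe_le_norm s).trans ht)
      rwa [map_smul, h_one] at h2
    exact hran v (‖H‖ + ‖F‖)
      ((neg_le_neg (hb H _ (le_add_of_nonneg_right (norm_nonneg F)))).trans h1)
      (h2.trans (hb F _ (le_add_of_nonneg_left (norm_nonneg H))))
  obtain ⟨A, hA⟩ := lift hhe hab.bounds.1 hab.bounds.2.1
  obtain ⟨B, hB⟩ := lift hhe hab.bounds.2.2.1 hab.bounds.2.2.2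
  obtain ⟨H, hH⟩ := lift hhe (neg_le_self h0) le_rfl
  obtain ⟨E, hE⟩ := lift hηe hcd.bounds.1 hcd.bounds.2.1
  obtain ⟨D, hD⟩ := lift hηe hcd.bounds.2.2.1 hcd.bounds.2.2.2
  obtain ⟨N, hN⟩ := lift hηe (neg_le_self η0) le_rfl
  obtain ⟨M, hM⟩ := lift hThe (neg_le_self (hT _ h0)) le_rfl
  have hHs : ∀ s, H s = ‖(⟨A s, B s⟩ : ℂ)‖ :=
    (isModulus_map_iff Ψ hΨ hran' A B H).1 (by rwa [hA, hB, hH])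
  have hNs : ∀ s, N s = ‖(⟨E s, D s⟩ : ℂ)‖ :=
    (isModulus_map_iff Ψ hΨ hran' E D N).1 (by rwa [hE, hD, hN])
  have hcont : Continuous fun s => phasePow k ⟨A s, B s⟩ := by
    simp only [Complex.mk_eq_add_mul_I]
    exact (continuous_phasePow k).comp (by fun_prop)
  let P : C(K, ℝ) := ⟨fun s => (phasePow k ⟨A s, B s⟩).re, Complex.continuous_re.comp hcont⟩
  let Q : C(K, ℝ) := ⟨fun s => (phasePow k ⟨A s, B s⟩).im, Complex.continuous_im.comp hcont⟩
  have hPQ : ∀ s, (⟨P s, Q s⟩ : ℂ) = phasePow k ⟨A s, B s⟩ := fun s => rfl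
  have hpq : IsModulus (Ψ P) (Ψ Q) h := by
    rw [← hH, isModulus_map_iff Ψ hΨ hran']
    intro s
    rw [hPQ, norm_phasePow, hHs]
  refine ⟨Ψ P, Ψ Q, hpq, ?_⟩
  obtain ⟨U, hU⟩ := lift (v := T (Ψ P)) hThe (by rw [← map_neg]; exact mono hpq.bounds.1)
    (mono hpq.bounds.2.1)
  obtain ⟨V, hV⟩ := lift (v := T (Ψ Q)) hThe (by rw [← map_neg]; exact mono hpq.bounds.2.2.1)
    (mono hpq.bounds.2.2.2)
  have key1 : ∀ γ : ℂ, ‖γ‖ = 1 → ∀ s,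
      γ.re * (l.re * A s - l.im * B s + E s) - γ.im * (l.im * A s + l.re * B s + D s) ≤ M s := by
    intro γ hγ s
    have h1 := mono (hab.re_mul_le hγ)
    rw [map_sub, map_smul, map_smul, ha, hb, ← hA, ← hB, ← hE, ← hD, ← hM] at h1
    simp only [← map_smul, ← map_sub, ← map_add] at h1
    rw [hΨ, ContinuousMap.le_def] at h1
    have := h1 s
    simp only [ContinuousMap.sub_apply, ContinuousMap.add_apply, ContinuousMap.smul_apply,
      smul_eq_mul] at this
    exact this
  have key2 : ∀ α c : ℂ, ‖α‖ = 1 → ‖c‖ = 1 → ∀ s, (α * c ^ k).re * U s - (α * c ^ k).im * V s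
      - α.re * M s - k * ((α * c).re * (l.re * A s - l.im * B s + E s)
        - (α * c).im * (l.im * A s + l.re * B s + D s)) + k * α.re * M s ≤
      2 * C * (M s - (c.re * (l.re * A s - l.im * B s + E s)
        - c.im * (l.im * A s + l.re * B s + D s))) := by
    intro α c hα hc s
    have h1 : (α * c ^ k).re • Ψ P - (α * c ^ k).im • Ψ Q
      - α.re • h - (k : ℝ) • ((α * c).re • a - (α * c).im • b) + ((k : ℝ) * α.re) • h ≤
      (2 * C) • (h - (c.re • a - c.im • b)) := by
      rw [← hA, ← hB, ← hH]
      simp only [← map_smul, ← map_sub, ← map_add]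
      rw [hΨ, ContinuousMap.le_def]
      intro s
      have := re_phasePow_le hC hα hc ⟨A s, B s⟩
      rw [← hPQ, ← hHs] at this
      have e1 : (α * (c ^ k * ⟨P s, Q s⟩ - (H s : ℂ) - k * (c * ⟨A s, B s⟩ - (H s : ℂ)))).re =
          (α * c ^ k * ⟨P s, Q s⟩).re - (α * (H s : ℂ)).re -
            (((k : ℝ) : ℂ) * (α * c * ⟨A s, B s⟩)).re + (((k : ℝ) : ℂ) * (α * (H s : ℂ))).re := by
        rw [← Complex.sub_re, ← Complex.sub_re, ← Complex.add_re]
        congr 1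
        push_cast
        ring
      rw [e1, Complex.re_ofReal_mul, Complex.re_ofReal_mul, Complex.re_mul_ofReal,
        Complex.mul_re (α * c ^ k), Complex.mul_re (α * c), Complex.mul_re c] at this
      simp only [ContinuousMap.sub_apply, ContinuousMap.add_apply, ContinuousMap.smul_apply,
        smul_eq_mul]
      linarith
    -- With `α` and `c` fixed, the pointwise inequality is an inequality in `X`, to which `T`
    -- applies; the result is read pointwise again.
    have h2 := mono h1
    simp only [map_add, map_sub, map_smul, ha, hb] at h2
    rw [← hU, ← hV, ← hA, ← hB, ← hE, ← hD, ← hM] at h2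
    simp only [← map_smul, ← map_sub, ← map_add] at h2
    rw [hΨ, ContinuousMap.le_def] at h2
    exact h2 s
  intro α hα
  rw [← hU, ← hV, ← hM, ← hH, ← hN]
  simp only [← map_smul, ← map_sub, ← map_add]
  rw [hΨ, ContinuousMap.le_def]
  intro s
  have e2 : l * ⟨A s, B s⟩ + ⟨E s, D s⟩ =
      (⟨l.re * A s - l.im * B s + E s, l.im * A s + l.re * B s + D s⟩ : ℂ) := by
    apply Complex.ext
    · simp
    · simp; ring
  have main := norm_sub_phasePow_le (k := k) hC0 (U := ⟨U s, V s⟩) (x := ⟨A s, B s⟩)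
    (ε := ⟨E s, D s⟩) (M := M s) hl
    (fun γ hγ => by rw [e2, Complex.mul_re]; exact key1 γ hγ s)
    (fun α c hα hc => by
      rw [e2]
      have e1 : ∀ z : ℂ, (α * (c ^ k * ⟨U s, V s⟩ - (M s : ℂ) - k * (c * z - (M s : ℂ)))).re =
          (α * c ^ k * ⟨U s, V s⟩).re - (α * (M s : ℂ)).re -
            (((k : ℝ) : ℂ) * (α * c * z)).re + (((k : ℝ) : ℂ) * (α * (M s : ℂ))).re := by
        intro z
        rw [← Complex.sub_re, ← Complex.sub_re, ← Complex.add_re]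
        congr 1
        push_cast
        ring
      have := key2 α c hα hc s
      rw [e1, Complex.re_ofReal_mul, Complex.re_ofReal_mul, Complex.re_mul_ofReal,
        Complex.mul_re (α * c ^ k), Complex.mul_re (α * c), Complex.mul_re c]
      linarith)
  rw [← hPQ, ← hHs, ← hNs] at main
  refine le_trans ?_ main
  have h3 := Complex.re_le_norm (α * (⟨U s, V s⟩ - l ^ k * ⟨P s, Q s⟩))
  rw [norm_mul, hα, one_mul] at h3
  refine le_trans (le_of_eq ?_) h3
  simp only [ContinuousMap.sub_apply, ContinuousMap.add_apply, ContinuousMap.smul_apply,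
    smul_eq_mul, Complex.mul_re, Complex.mul_im, Complex.sub_re, Complex.sub_im]
  ring

end Modulus

/-! ### Modulus, real part and positive operators on a complex Banach lattice. -/

namespace ComplexBanachLattice

variable {X E : Type*}
  [NormedAddCommGroup X] [Lattice X] [IsOrderedAddMonoid X] [HasSolidNorm X]
  [NormedSpace ℝ X] [IsOrderedModule ℝ X] [CompleteSpace X]
  [NormedAddCommGroup E] [NormedSpace ℂ E] [CompleteSpace E]
  (L : ComplexBanachLattice X E)

theorem complex_smul_ofReal (c : ℂ) (x y : X) :
    c • (L.ofReal x + Complex.I • L.ofReal y) =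
      L.ofReal (c.re • x - c.im • y) + Complex.I • L.ofReal (c.im • x + c.re • y) := by
  have h : ∀ (r : ℝ) (x : X), L.ofReal (r • x) = (r : ℂ) • L.ofReal x := fun r x => by
    rw [map_smul, Complex.coe_smul]
  conv_lhs => rw [← Complex.re_add_im c]
  rw [map_sub, map_add, h, h, h, h]
  simp only [smul_add, add_smul, smul_smul, add_mul]
  have hI : (c.im : ℂ) * Complex.I * Complex.I = -c.im := by
    rw [mul_assoc, Complex.I_mul_I, mul_neg_one]
  rw [hI, neg_smul, mul_comm (c.im : ℂ), mul_comm (c.re : ℂ)]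
  abel

/-- The real and imaginary part. -/
noncomputable def parts : E → X × X := (Equiv.ofBijective _ L.bijective).symm

theorem parts_spec (z : E) : L.ofReal (L.parts z).1 + Complex.I • L.ofReal (L.parts z).2 = z :=
  (Equiv.ofBijective _ L.bijective).apply_symm_apply z

theorem parts_eq (x y : X) : L.parts (L.ofReal x + Complex.I • L.ofReal y) = (x, y) :=
  (Equiv.ofBijective _ L.bijective).symm_apply_apply (x, y)

theorem parts_add (z w : E) : L.parts (z + w) = L.parts z + L.parts w := by
  conv_lhs => rw [← L.parts_spec z, ← L.parts_spec w]
  rw [add_add_add_comm, ← map_add, ← smul_add, ← map_add, parts_eq]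
  rfl

theorem parts_smul (c : ℂ) (z : E) : L.parts (c • z) =
    (c.re • (L.parts z).1 - c.im • (L.parts z).2, c.im • (L.parts z).1 + c.re • (L.parts z).2) := by
  conv_lhs => rw [← L.parts_spec z]
  rw [complex_smul_ofReal, parts_eq]

/-- The modulus of an element of a complex Banach lattice. -/
noncomputable def modulus (z : E) : X := (L.norm_eq (L.parts z).1 (L.parts z).2).choose

theorem isModulus_modulus (z : E) : IsModulus (L.parts z).1 (L.parts z).2 (L.modulus z) :=
  (L.norm_eq (L.parts z).1 (L.parts z).2).choose_spec.1

theorem norm_modulus (z : E) : ‖L.modulus z‖ = ‖z‖ := by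
  exact (L.norm_eq (L.parts z).1 (L.parts z).2).choose_spec.2.symm.trans
    (congrArg norm (L.parts_spec z))

theorem modulus_nonneg (z : E) : 0 ≤ L.modulus z := (L.isModulus_modulus z).nonneg

theorem modulus_eq_of_isModulus {x y m : X} (h : IsModulus x y m) :
    L.modulus (L.ofReal x + Complex.I • L.ofReal y) = m := by
  have := L.isModulus_modulus (L.ofReal x + Complex.I • L.ofReal y)
  rw [parts_eq] at this
  exact this.unique h

/-- The real part as a continuous linear map. -/
noncomputable def re : E →L[ℝ] X :=
  LinearMap.mkContinuous
    { toFun := fun z => (L.parts z).1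
      map_add' := fun z w => by rw [parts_add]; rfl
      map_smul' := fun c z => by rw [← Complex.coe_smul, parts_smul]; simp } 1 fun z => by
    rw [one_mul, ← L.norm_modulus]
    exact norm_le_of_neg_le_of_le (L.isModulus_modulus z).bounds.1 (L.isModulus_modulus z).bounds.2.1

theorem re_apply (z : E) : L.re z = (L.parts z).1 := rfl

theorem norm_re_le (z : E) : ‖L.re z‖ ≤ ‖z‖ := by
  rw [← L.norm_modulus]
  exact norm_le_of_neg_le_of_le (L.isModulus_modulus z).bounds.1 (L.isModulus_modulus z).bounds.2.1

theorem re_ofReal (x : X) : L.re (L.ofReal x) = x := by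
  have := L.parts_eq x 0
  rw [map_zero, smul_zero, add_zero] at this
  rw [re_apply, this]

theorem re_smul_le_modulus (z : E) {α : ℂ} (hα : ‖α‖ = 1) : L.re (α • z) ≤ L.modulus z := by
  rw [re_apply, parts_smul]
  exact (L.isModulus_modulus z).re_mul_le hα

theorem modulus_le {z : E} {n : X} (h : ∀ α : ℂ, ‖α‖ = 1 → L.re (α • z) ≤ n) :
    L.modulus z ≤ n :=
  (L.isModulus_modulus z).le fun α hα => by
    have := h α hα
    rwa [re_apply, parts_smul] at this

theorem modulus_add_le (z w : E) : L.modulus (z + w) ≤ L.modulus z + L.modulus w :=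
  L.modulus_le fun α hα => by
    rw [smul_add, map_add]
    exact add_le_add (L.re_smul_le_modulus z hα) (L.re_smul_le_modulus w hα)

theorem modulus_sum_le {ι : Type*} (s : Finset ι) (f : ι → E) :
    L.modulus (∑ i ∈ s, f i) ≤ ∑ i ∈ s, L.modulus (f i) :=
  L.modulus_le fun α hα => by
    rw [Finset.smul_sum, map_sum]
    exact Finset.sum_le_sum fun i _ => L.re_smul_le_modulus (f i) hα

theorem modulus_smul_le {c : ℂ} (hc : ‖c‖ ≤ 1) (z : E) : L.modulus (c • z) ≤ L.modulus z :=
  L.modulus_le fun α hα => by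
    by_cases h0 : c = 0
    · rw [h0, zero_smul, smul_zero, map_zero]; exact L.modulus_nonneg z
    · have hn : ‖c‖ ≠ 0 := norm_ne_zero_iff.2 h0
      have h1 : α • c • z = ‖c‖ • ((α * (c / ‖c‖)) • z) := by
        have : (‖c‖ : ℂ) ≠ 0 := by exact_mod_cast hn
        rw [← Complex.coe_smul, smul_smul, smul_smul]
        congr 1
        field_simp
      rw [h1, map_smul]
      have h2 : ‖α * (c / ‖c‖)‖ = 1 := by
        rw [norm_mul, hα, one_mul, norm_div, Complex.norm_real, norm_norm, div_self hn]
      calc ‖c‖ • L.re ((α * (c / ‖c‖)) • z) ≤ ‖c‖ • L.modulus z :=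
            smul_le_smul_of_nonneg_left (L.re_smul_le_modulus z h2) (norm_nonneg c)
        _ ≤ (1 : ℝ) • L.modulus z := smul_le_smul_of_le_of_nonneg (L.modulus_nonneg z) hc
        _ = _ := one_smul _ _

theorem norm_ofReal (x : X) : ‖L.ofReal x‖ = ‖x‖ := by
  refine le_antisymm ?_ ?_
  · rw [← L.norm_modulus, ← norm_abs_eq_norm x]
    refine norm_le_of_neg_le_of_le ?_ ?_
    · exact (neg_nonpos.2 (abs_nonneg x)).trans (L.modulus_nonneg _)
    · refine L.modulus_le fun α hα => ?_
      have h1 : L.re (α • L.ofReal x) = α.re • x := by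
        have := L.parts_eq x 0
        rw [map_zero, smul_zero, add_zero] at this
        rw [re_apply, parts_smul, this]
        simp
      rw [h1]
      have h2 := abs_le.1 ((Complex.abs_re_le_norm α).trans hα.le)
      -- A convex combination of `x` and `-x`, each of which is at most `|x|`.
      have h3 : α.re • x = (((1 + α.re) / 2) • x) + (((1 - α.re) / 2) • (-x)) := by
        rw [smul_neg, ← sub_eq_add_neg, ← sub_smul]; congr 1; ring
      rw [h3]
      calc _ ≤ ((1 + α.re) / 2) • |x| + ((1 - α.re) / 2) • |x| :=
            add_le_add (smul_le_smul_of_nonneg_left (le_abs_self x) (by linarith))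
              (smul_le_smul_of_nonneg_left (neg_le_abs x) (by linarith))
        _ = |x| := by rw [← add_smul]; ring_nf; exact one_smul _ _
  · have := L.norm_re_le (L.ofReal x)
    rwa [re_ofReal] at this

/-- The restriction of an operator to the real part. -/
noncomputable def realRestrict (T : E →L[ℂ] E) : X →L[ℝ] X :=
  L.re ∘L (T.restrictScalars ℝ) ∘L
    (L.ofReal.mkContinuous 1 fun x => by rw [one_mul, norm_ofReal])

theorem realRestrict_apply (T : E →L[ℂ] E) (x : X) :
    L.realRestrict T x = L.re (T (L.ofReal x)) := rfl

variable {L} {T : E →L[ℂ] E}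

theorem IsPositive.map_ofReal (hT : L.IsPositive T) (x : X) :
    T (L.ofReal x) = L.ofReal (L.realRestrict T x) := by
  obtain ⟨y, -, hy⟩ := hT x⁺ (posPart_nonneg x)
  obtain ⟨y', -, hy'⟩ := hT x⁻ (negPart_nonneg x)
  have h : T (L.ofReal x) = L.ofReal (y - y') := by
    conv_lhs => rw [← posPart_sub_negPart x, map_sub, map_sub, hy, hy', ← map_sub]
  rw [realRestrict_apply, h, re_ofReal]

theorem IsPositive.realRestrict_nonneg (hT : L.IsPositive T) {x : X} (hx : 0 ≤ x) :
    0 ≤ L.realRestrict T x := by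
  obtain ⟨y, hy0, hy⟩ := hT x hx
  rwa [realRestrict_apply, hy, re_ofReal]

theorem IsPositive.realRestrict_mono (hT : L.IsPositive T) {x y : X} (h : x ≤ y) :
    L.realRestrict T x ≤ L.realRestrict T y := by
  have := hT.realRestrict_nonneg (sub_nonneg.2 h)
  rwa [map_sub, sub_nonneg] at this

theorem IsPositive.parts_map (hT : L.IsPositive T) (z : E) : L.parts (T z) =
    (L.realRestrict T (L.parts z).1, L.realRestrict T (L.parts z).2) := by
  conv_lhs => rw [← L.parts_spec z]
  rw [map_add, map_smul, hT.map_ofReal, hT.map_ofReal, parts_eq]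

theorem IsPositive.pow (hT : L.IsPositive T) (n : ℕ) : L.IsPositive (T ^ n) := by
  induction n with
  | zero => exact fun x hx => ⟨x, hx, rfl⟩
  | succ n ih =>
    intro x hx
    obtain ⟨y, hy0, hy⟩ := ih x hx
    obtain ⟨v, hv0, hv⟩ := hT y hy0
    exact ⟨v, hv0, by rw [pow_succ', mul_apply_eq_comp, hy, hv]⟩

theorem IsPositive.realRestrict_mul {S : E →L[ℂ] E} (hT : L.IsPositive T) (x : X) :
    L.realRestrict (S * T) x = L.realRestrict S (L.realRestrict T x) := by
  change L.re (S (T (L.ofReal x))) = _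
  rw [hT.map_ofReal]
  rfl

theorem norm_realRestrict_apply_le (S : E →L[ℂ] E) (x : X) :
    ‖L.realRestrict S x‖ ≤ ‖S‖ * ‖x‖ := by
  rw [realRestrict_apply]
  exact (L.norm_re_le _).trans ((S.le_opNorm _).trans_eq (by rw [norm_ofReal]))

theorem IsPositive.modulus_map_le (hT : L.IsPositive T) (z : E) :
    L.modulus (T z) ≤ L.realRestrict T (L.modulus z) :=
  L.modulus_le fun α hα => by
    rw [← map_smul, re_apply, hT.parts_map]
    exact hT.realRestrict_mono (L.re_smul_le_modulus z hα)

/-- Complex form of `exists_isModulus_zpow`. The constant is chosen before `l` and `z`, so one `D`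
serves a whole sequence of approximate eigenvectors. -/
theorem IsPositive.exists_modulus_zpow_eigenvector_le (hT : L.IsPositive T) (k : ℤ) :
    ∃ D : ℝ, 0 ≤ D ∧ ∀ l : ℂ, ‖l‖ = 1 → ∀ z : E, z ≠ 0 → ∃ u : E, L.modulus u = L.modulus z ∧
      L.modulus (T u - l ^ k • u) ≤ D • (L.realRestrict T (L.modulus z) - L.modulus z +
        (2 : ℝ) • L.modulus (T z - l • z)) := by
  obtain ⟨C, hC0, hC⟩ := exists_forall_norm_zpow_sub_le k
  refine ⟨2 * C + 1 + 2 * |k|, by positivity, fun l hl z hz => ?_⟩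
  have hz' : L.modulus z ≠ 0 := by rwa [← norm_ne_zero_iff, norm_modulus, norm_ne_zero_iff]
  have hTz : T z = l • z + (T z - l • z) := by abel
  have hparts := hT.parts_map z
  rw [hTz, parts_add, parts_smul] at hparts
  obtain ⟨p, q, hpq, h⟩ := exists_isModulus_zpow hC0 hC (L.realRestrict T).toLinearMap
    (fun x hx => hT.realRestrict_nonneg hx) hl hz' (L.isModulus_modulus z)
    (L.isModulus_modulus (T z - l • z)) (congrArg Prod.fst hparts).symm
    (congrArg Prod.snd hparts).symm
  refine ⟨L.ofReal p + Complex.I • L.ofReal q, L.modulus_eq_of_isModulus hpq,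
    L.modulus_le fun α hα => ?_⟩
  refine le_trans (le_of_eq ?_) (h α hα)
  rw [map_add, map_smul T, hT.map_ofReal, hT.map_ofReal, complex_smul_ofReal,
    add_sub_add_comm, ← map_sub, ← smul_sub, ← map_sub, complex_smul_ofReal, re_apply, parts_eq]
  rfl

end ComplexBanachLattice

/-! ### Resolvents, analytic calculus and approximate eigenvectors. -/

open Filter Topology in
theorem exists_norm_pow_le_of_spectralRadius_lt {A : Type*} [NormedRing A] [NormedAlgebra ℂ A]
    [CompleteSpace A] {T : A} {ρ : ℝ} (hρ : 0 < ρ) (h : spectralRadius ℂ T < ENNReal.ofReal ρ) :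
    ∃ K : ℝ, 0 ≤ K ∧ ∀ n, ‖T ^ n‖ ≤ K * ρ ^ n := by
  have h1 : ∀ᶠ n : ℕ in atTop, ‖T ^ n‖ ≤ ρ ^ n := by
    filter_upwards [(spectrum.pow_nnnorm_pow_one_div_tendsto_nhds_spectralRadius T).eventually_lt_const
      h, eventually_gt_atTop 0] with n hn hn0
    have hn1 : (n : ℝ) ≠ 0 := by positivity
    have h2 := ENNReal.rpow_le_rpow hn.le (Nat.cast_nonneg n)
    rw [← ENNReal.rpow_mul, one_div_mul_cancel hn1, ENNReal.rpow_one, ENNReal.rpow_natCast,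
      ← ENNReal.ofReal_pow hρ.le] at h2
    rw [← enorm_eq_nnnorm, ← ofReal_norm, ENNReal.ofReal_le_ofReal_iff (by positivity)] at h2
    exact h2
  obtain ⟨N, hN⟩ := eventually_atTop.1 h1
  refine ⟨1 + ∑ i ∈ Finset.range N, ‖T ^ i‖ / ρ ^ i, by positivity, fun n => ?_⟩
  have hs : 0 ≤ ∑ i ∈ Finset.range N, ‖T ^ i‖ / ρ ^ i := by positivity
  rcases lt_or_ge n N with hn | hn
  · have := Finset.single_le_sum (f := fun i => ‖T ^ i‖ / ρ ^ i) (fun i _ => by positivity)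
      (Finset.mem_range.2 hn)
    rw [← div_le_iff₀ (by positivity)]
    linarith
  · refine (hN n hn).trans ?_
    have : 0 < ρ ^ n := by positivity
    nlinarith

theorem hasSum_resolvent {A : Type*} [NormedRing A] [NormedAlgebra ℂ A] [CompleteSpace A] {T : A}
    {z : ℂ} (h : spectralRadius ℂ T < ENNReal.ofReal ‖z‖) :
    HasSum (fun n : ℕ => z⁻¹ ^ (n + 1) • T ^ n) (resolvent T z) := by
  obtain ⟨ρ', h1, h2⟩ := exists_between h
  lift ρ' to NNReal using h2.ne_top
  have hz : 0 < ‖z‖ := ENNReal.ofReal_pos.1 (zero_le.trans_lt h)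
  have hρ0 : (0 : ℝ) < ρ' := by exact_mod_cast zero_le.trans_lt h1
  have hρz : (ρ' : ℝ) < ‖z‖ := by
    rwa [← ENNReal.ofReal_coe_nnreal, ENNReal.ofReal_lt_ofReal_iff hz] at h2
  have hz0 : z ≠ 0 := norm_pos_iff.1 hz
  obtain ⟨K, hK0, hK⟩ := exists_norm_pow_le_of_spectralRadius_lt hρ0
    (by rwa [ENNReal.ofReal_coe_nnreal])
  have hsum : Summable fun n : ℕ => (z⁻¹ • T) ^ n := by
    refine Summable.of_norm_bounded (g := fun n : ℕ => K * ((ρ' : ℝ) / ‖z‖) ^ n)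
      ((summable_geometric_of_lt_one (by positivity) ((div_lt_one hz).2 hρz)).mul_left K)
      fun n => ?_
    rw [smul_pow, norm_smul, norm_pow, norm_inv, div_pow, inv_pow, mul_div_assoc', div_eq_inv_mul]
    gcongr
    exact hK n
  have h3 : HasSum (fun n : ℕ => z⁻¹ ^ (n + 1) • T ^ n) (z⁻¹ • ∑' n, (z⁻¹ • T) ^ n) := by
    have := hsum.hasSum.const_smul z⁻¹
    simpa only [smul_pow, smul_smul, ← pow_succ'] using this
  have e1 : algebraMap ℂ A z - T = z • (1 - z⁻¹ • T) := by
    rw [smul_sub, smul_smul, mul_inv_cancel₀ hz0, one_smul, Algebra.algebraMap_eq_smul_one]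
  have e2 : resolvent T z = z⁻¹ • ∑' n, (z⁻¹ • T) ^ n := by
    have h4 : (algebraMap ℂ A z - T) * (z⁻¹ • ∑' n, (z⁻¹ • T) ^ n) = 1 := by
      rw [e1, smul_mul_smul_comm, mul_inv_cancel₀ hz0, one_smul, hsum.one_sub_mul_tsum_pow]
    have h5 : (z⁻¹ • ∑' n, (z⁻¹ • T) ^ n) * (algebraMap ℂ A z - T) = 1 := by
      rw [e1, smul_mul_smul_comm, inv_mul_cancel₀ hz0, one_smul, hsum.tsum_pow_mul_one_sub]
    exact Ring.inverse_unit (⟨_, _, h4, h5⟩ : Aˣ)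
  rw [e2]
  exact h3

theorem iteratedDeriv_div_factorial_eq_circleIntegral {f : ℂ → ℂ} {R : ℝ} (hR : 0 < R)
    (hf : AnalyticOnNhd ℂ f (Metric.closedBall 0 R)) (n : ℕ) :
    iteratedDeriv n f 0 / n.factorial =
      (2 * Real.pi * Complex.I : ℂ)⁻¹ • ∮ z in C(0, R), f z • z⁻¹ ^ (n + 1) := by
  lift R to NNReal using hR.le
  have h1 := (hf.differentiableOn.hasFPowerSeriesOnBall (by exact_mod_cast hR)).hasFPowerSeriesAt
  have h2 := (hf 0 (by simp)).hasFPowerSeriesAt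
  have h3 := congrArg (fun p => p n fun _ => (1 : ℂ)) (h2.eq_formalMultilinearSeries h1)
  rw [cauchyPowerSeries_apply, FormalMultilinearSeries.ofScalars_apply_eq, one_pow, smul_eq_mul,
    mul_one] at h3
  rw [h3]
  congr 2
  ext z
  simp only [sub_zero, one_div, smul_eq_mul, pow_succ]
  ring

/-- The Neumann series of the resolvent is integrated termwise over the circle. With `ρ'` strictly
between the spectral radius and `R`, the terms are dominated by a geometric series in `ρ' / R`,
which also yields absolute summability. -/
theorem IsAnalyticCalculus.hasSum {E : Type*} [NormedAddCommGroup E] [NormedSpace ℂ E]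
    [CompleteSpace E] {T S : E →L[ℂ] E} {f : ℂ → ℂ} (h : IsAnalyticCalculus T f S) :
    HasSum (fun n : ℕ => (iteratedDeriv n f 0 / n.factorial : ℂ) • T ^ n) S ∧
      Summable fun n : ℕ => ‖(iteratedDeriv n f 0 / n.factorial : ℂ)‖ * ‖T ^ n‖ := by
  obtain ⟨R, hR, hf, rfl⟩ := h
  have hR0 : 0 < R := ENNReal.ofReal_pos.1 (zero_le.trans_lt hR)
  obtain ⟨ρ', h1, h2⟩ := exists_between hR
  lift ρ' to NNReal using h2.ne_top
  have hρ0 : (0 : ℝ) < ρ' := by exact_mod_cast zero_le.trans_lt h1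
  have hρR : (ρ' : ℝ) < R := by
    rwa [← ENNReal.ofReal_coe_nnreal, ENNReal.ofReal_lt_ofReal_iff hR0] at h2
  obtain ⟨K, hK0, hK⟩ := exists_norm_pow_le_of_spectralRadius_lt hρ0
    (by rwa [ENNReal.ofReal_coe_nnreal])
  obtain ⟨B, hB⟩ := (isCompact_closedBall (0 : ℂ) R).exists_bound_of_continuousOn hf.continuousOn
  have hmem : ∀ θ, circleMap 0 R θ ∈ Metric.closedBall (0 : ℂ) R := fun θ =>
    circleMap_mem_closedBall _ hR0.le θ
  have hB0 : 0 ≤ B := (norm_nonneg _).trans (hB _ (hmem 0))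
  have hgeom : Summable fun n : ℕ => B * K * ((ρ' : ℝ) / R) ^ n :=
    (summable_geometric_of_lt_one (by positivity) ((div_lt_one hR0).2 hρR)).mul_left _
  have hfc : Continuous fun θ => f (circleMap 0 R θ) :=
    hf.continuousOn.comp_continuous (continuous_circleMap 0 R) hmem
  have hne : ∀ θ, circleMap 0 R θ ≠ 0 := fun θ => circleMap_ne_center hR0.ne'
  have hnorm : ∀ θ, ‖circleMap 0 R θ‖ = R := fun θ => by simp [abs_of_pos hR0]
  have hsum : HasSum (fun n : ℕ => ∮ z in C(0, R), (f z • z⁻¹ ^ (n + 1)) • T ^ n)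
      (∮ z in C(0, R), f z • resolvent T z) := by
    unfold circleIntegral
    refine intervalIntegral.hasSum_integral_of_dominated_convergence
      (fun n _ => B * K * ((ρ' : ℝ) / R) ^ n) (fun n => ?_) (fun n => ?_) ?_ ?_ ?_
    · refine Continuous.aestronglyMeasurable ?_
      simp only [deriv_circleMap]
      have := (continuous_circleMap 0 R).inv₀ hne
      exact ((continuous_circleMap 0 R).mul continuous_const).smul
        ((hfc.smul (this.pow (n + 1))).smul continuous_const)
    · refine Filter.Eventually.of_forall fun θ _ => ?_
      rw [norm_smul, norm_smul, norm_smul, deriv_circleMap, norm_mul, Complex.norm_I, mul_one,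
        norm_pow, norm_inv, hnorm]
      calc R * (‖f (circleMap 0 R θ)‖ * R⁻¹ ^ (n + 1) * ‖T ^ n‖)
          ≤ R * (B * R⁻¹ ^ (n + 1) * (K * (ρ' : ℝ) ^ n)) := by
            gcongr
            · exact hB _ (hmem θ)
            · exact hK n
        _ = B * K * ((ρ' : ℝ) / R) ^ n := by
            rw [pow_succ, div_pow, inv_pow]; field_simp
    · exact Filter.Eventually.of_forall fun θ _ => hgeom
    · exact intervalIntegrable_const
    · refine Filter.Eventually.of_forall fun θ _ => ?_
      have := ((hasSum_resolvent (T := T) (z := circleMap 0 R θ) (by rwa [hnorm])).const_smul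
        (f (circleMap 0 R θ))).const_smul (deriv (circleMap 0 R) θ)
      simpa only [smul_assoc] using this
  have hcoef := iteratedDeriv_div_factorial_eq_circleIntegral hR0 hf
  refine ⟨?_, ?_⟩
  · simp only [circleIntegral.integral_smul_const] at hsum
    simpa only [hcoef, smul_assoc] using hsum.const_smul (2 * Real.pi * Complex.I : ℂ)⁻¹
  · refine Summable.of_nonneg_of_le (fun n => by positivity) (fun n => ?_) hgeom
    have : ‖(iteratedDeriv n f 0 / n.factorial : ℂ)‖ ≤ R * (B * R⁻¹ ^ (n + 1)) := by
      rw [hcoef]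
      refine circleIntegral.norm_two_pi_i_inv_smul_integral_le_of_norm_le_const hR0.le ?_
      intro z hz
      rw [norm_smul, norm_pow, norm_inv, mem_sphere_zero_iff_norm.1 hz]
      gcongr
      exact hB z (Metric.sphere_subset_closedBall hz)
    calc _ ≤ R * (B * R⁻¹ ^ (n + 1)) * (K * (ρ' : ℝ) ^ n) := by gcongr; exact hK n
      _ = _ := by rw [pow_succ, div_pow, inv_pow]; field_simp

-- The resolvent is continuous at `μ`, and at `r * μ` with `r > 1` its Neumann series converges. The
-- coefficients are powers of `(r * μ)⁻¹`, hence bounded by `1` however close `r` is to `1`.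
open Filter Topology in
theorem exists_sum_pow_near_resolvent {A : Type*} [NormedRing A] [NormedAlgebra ℂ A]
    [CompleteSpace A] {T : A} (hr : spectralRadius ℂ T = 1) {μ : ℂ} (hμ : ‖μ‖ = 1)
    (hμT : μ ∉ spectrum ℂ T) {δ : ℝ} (hδ : 0 < δ) :
    ∃ (M : ℕ) (c : ℕ → ℂ), (∀ m, ‖c m‖ ≤ 1) ∧
      ‖resolvent T μ - ∑ m ∈ Finset.range M, c m • T ^ m‖ ≤ δ := by
  have hμT' : μ ∈ resolventSet ℂ T := by
    by_contra h; exact hμT h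
  have hcont : ContinuousAt (resolvent T) μ :=
    (spectrum.hasDerivAt_resolvent_const_left hμT').continuousAt
  have h1 : Tendsto (fun r : ℝ => (r : ℂ) * μ) (𝓝[>] 1) (𝓝 μ) := by
    have : Continuous fun r : ℝ => (r : ℂ) * μ := by fun_prop
    simpa using (this.tendsto 1).mono_left nhdsWithin_le_nhds
  obtain ⟨r, hr1, hr2⟩ := ((Metric.tendsto_nhds.1 (hcont.tendsto.comp h1) (δ / 2)
    (half_pos hδ)).and self_mem_nhdsWithin).exists
  have hr2' : (1 : ℝ) < r := hr2
  have hnorm : ‖(r : ℂ) * μ‖ = r := by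
    rw [norm_mul, hμ, mul_one, Complex.norm_real, Real.norm_of_nonneg (by linarith)]
  have hs := hasSum_resolvent (T := T) (z := (r : ℂ) * μ) (by
    rw [hr, hnorm, ← ENNReal.ofReal_one]
    exact (ENNReal.ofReal_lt_ofReal_iff (by linarith)).2 hr2')
  obtain ⟨M, hM⟩ := (Metric.tendsto_nhds.1 hs.tendsto_sum_nat (δ / 2) (half_pos hδ)).exists
  refine ⟨M, fun m => ((r : ℂ) * μ)⁻¹ ^ (m + 1), fun m => ?_, ?_⟩
  · rw [norm_pow, norm_inv, hnorm]
    exact pow_le_one₀ (by positivity) (inv_le_one_of_one_le₀ hr2'.le)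
  · rw [← dist_eq_norm]
    have h2 := dist_triangle (resolvent T μ) (resolvent T ((r : ℂ) * μ))
      (∑ m ∈ Finset.range M, ((r : ℂ) * μ)⁻¹ ^ (m + 1) • T ^ m)
    rw [dist_comm] at hM hr1
    simp only [Function.comp_apply] at hr1
    linarith

theorem exists_approximate_eigenvector {E : Type*} [NormedAddCommGroup E] [NormedSpace ℂ E]
    [CompleteSpace E] {T : E →L[ℂ] E} (hr : spectralRadius ℂ T = 1) {l : ℂ} (hl : ‖l‖ = 1)
    (hlT : l ∈ spectrum ℂ T) {ε : ℝ} (hε : 0 < ε) : ∃ x : E, ‖x‖ = 1 ∧ ‖T x - l • x‖ ≤ ε := by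
  by_contra! hcon
  have hbound : ∀ x : E, ε * ‖x‖ ≤ ‖T x - l • x‖ := by
    intro x
    by_cases hx : x = 0
    · simp [hx]
    have hx' : ‖x‖ ≠ 0 := norm_ne_zero_iff.2 hx
    have h1 := hcon (((‖x‖ : ℂ)⁻¹) • x) (by
      rw [norm_smul, norm_inv, Complex.norm_real, norm_norm, inv_mul_cancel₀ hx'])
    rw [map_smul, smul_comm, ← smul_sub, norm_smul, norm_inv, Complex.norm_real, norm_norm,
      lt_inv_mul_iff₀ (by positivity)] at h1
    linarith
  -- If `T - l` is bounded below by `ε = 3t`, then `T - μ` with `μ = (1 + t) l` is bounded below by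
  -- `2t`. The resolvent at `μ` then has norm at most `1 / (2t)`, and a step of length `t` back to
  -- `l` stays in the resolvent set.
  set t : ℝ := ε / 3 with ht
  have ht0 : 0 < t := by positivity
  set μ : ℂ := ((1 + t : ℝ) : ℂ) * l with hμ
  have hμn : ‖μ‖ = 1 + t := by
    rw [hμ, norm_mul, hl, mul_one, Complex.norm_real, Real.norm_of_nonneg (by positivity)]
  have hμT : μ ∈ resolventSet ℂ T := by
    refine spectrum.mem_resolventSet_of_spectralRadius_lt ?_
    rw [hr, ← enorm_eq_nnnorm, ← ofReal_norm, hμn, ← ENNReal.ofReal_one]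
    exact (ENNReal.ofReal_lt_ofReal_iff (by linarith)).2 (by linarith)
  obtain ⟨W, hW⟩ : IsUnit (algebraMap ℂ (E →L[ℂ] E) μ - T) := hμT
  have hVbound : ‖((W⁻¹ : (E →L[ℂ] E)ˣ) : E →L[ℂ] E)‖ ≤ (2 * t)⁻¹ := by
    refine ContinuousLinearMap.opNorm_le_bound _ (by positivity) fun y => ?_
    set x := ((W⁻¹ : (E →L[ℂ] E)ˣ) : E →L[ℂ] E) y with hx
    have hy : μ • x - T x = y := by
      have h2 : (W : E →L[ℂ] E) x = y := by
        rw [hx, ← mul_apply_eq_comp, Units.mul_inv]; rfl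
      rw [hW] at h2
      exact h2
    have h3 := hbound x
    have h4 : T x - l • x = ((t : ℂ) * l) • x - y := by
      rw [← hy, hμ]; push_cast; rw [add_mul, one_mul, add_smul]; abel
    rw [h4] at h3
    have h5 := norm_sub_le (((t : ℂ) * l) • x) y
    rw [norm_smul, norm_mul, hl, mul_one, Complex.norm_real, Real.norm_of_nonneg ht0.le] at h5
    rw [le_inv_mul_iff₀ (by positivity)]
    have : ε = 3 * t := by rw [ht]; ring
    rw [this] at h3
    linarith
  refine hlT ?_
  have hfac : algebraMap ℂ (E →L[ℂ] E) l - T =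
      (W : E →L[ℂ] E) * (1 - ((t : ℂ) * l) • ((W⁻¹ : (E →L[ℂ] E)ˣ) : E →L[ℂ] E)) := by
    rw [mul_sub, mul_one, mul_smul_comm, Units.mul_inv, hW, hμ]
    simp only [Algebra.algebraMap_eq_smul_one]
    push_cast
    rw [add_mul, one_mul, add_smul]
    abel
  change IsUnit _
  rw [hfac]
  refine W.isUnit.mul (isUnit_one_sub_of_norm_lt_one ?_)
  rw [norm_smul, norm_mul, hl, mul_one, Complex.norm_real, Real.norm_of_nonneg ht0.le]
  calc t * _ ≤ t * (2 * t)⁻¹ := by gcongr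
    _ = 1 / 2 := by field_simp
    _ < 1 := by norm_num

/-! ### Positive norming functionals. -/

section Functional

theorem smul_posPart_of_pos {X : Type*} [AddCommGroup X] [Lattice X] [Module ℝ X]
    [IsOrderedModule ℝ X] {c : ℝ} (hc : 0 < c) (x : X) : (c • x)⁺ = c • x⁺ := by
  have h : ∀ {c : ℝ}, 0 < c → ∀ x : X, (c • x)⁺ ≤ c • x⁺ := fun {c} hc x =>
    sup_le (smul_le_smul_of_nonneg_left le_sup_left hc.le)
      (smul_nonneg hc.le (posPart_nonneg x))
  refine (h hc x).antisymm ?_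
  have h1 := smul_le_smul_of_nonneg_left (h (inv_pos.2 hc) (c • x)) hc.le
  rwa [smul_smul, smul_smul, inv_mul_cancel₀ hc.ne', mul_inv_cancel₀ hc.ne', one_smul,
    one_smul] at h1

variable {X : Type*} [NormedAddCommGroup X] [Lattice X] [IsOrderedAddMonoid X] [HasSolidNorm X]
  [NormedSpace ℝ X] [IsOrderedModule ℝ X]

/-- Positive norming functionals. -/
theorem exists_positive_functional {h : X} (h0 : 0 ≤ h) (hne : h ≠ 0) :
    ∃ φ : X →ₗ[ℝ] ℝ, (∀ x, 0 ≤ x → 0 ≤ φ x) ∧ (∀ x, φ x ≤ ‖x‖) ∧ φ h = ‖h‖ := by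
  -- Hahn–Banach with the majorant `‖x⁺‖`: it vanishes on negative elements, which forces the
  -- extension to be positive.
  obtain ⟨φ, h1, h2⟩ := exists_extension_of_le_sublinear
    (LinearPMap.mkSpanSingleton' (σ := RingHom.id ℝ) h ‖h‖ fun c hc => by
      have : c = 0 := (smul_eq_zero.1 hc).resolve_right hne
      simp [this]) (fun x => ‖x⁺‖)
    (fun c hc x => by
      rw [smul_posPart_of_pos hc, norm_smul, Real.norm_of_nonneg hc.le])
    (fun x y => by
      refine (norm_le_of_neg_le_of_le (w := x⁺ + y⁺) ?_ ?_).trans (norm_add_le _ _)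
      · exact (neg_nonpos.2 (add_nonneg (posPart_nonneg x) (posPart_nonneg y))).trans
          (posPart_nonneg _)
      · exact sup_le (add_le_add (le_posPart x) (le_posPart y))
          (add_nonneg (posPart_nonneg x) (posPart_nonneg y)))
    (by
      rintro ⟨x, hx⟩
      obtain ⟨c, rfl⟩ := Submodule.mem_span_singleton.1 hx
      rw [LinearPMap.mkSpanSingleton'_apply]
      rcases le_or_gt c 0 with hc | hc
      · exact (mul_nonpos_of_nonpos_of_nonneg hc (norm_nonneg h)).trans (norm_nonneg _)
      · dsimp only
        rw [smul_posPart_of_pos hc, posPart_eq_self.2 h0, norm_smul, Real.norm_of_nonneg hc.le]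
        exact le_rfl)
  refine ⟨φ, fun x hx => ?_, fun x => (h2 x).trans ?_, ?_⟩
  · have := h2 (-x)
    rw [posPart_eq_zero.2 (neg_nonpos.2 hx), norm_zero, map_neg] at this
    linarith
  · rw [← norm_abs_eq_norm x]
    exact norm_le_of_neg_le_of_le ((neg_nonpos.2 (abs_nonneg x)).trans (posPart_nonneg x))
      (sup_le (le_abs_self x) (abs_nonneg x))
  · exact (h1 ⟨h, Submodule.mem_span_singleton_self h⟩).trans
      (LinearPMap.mkSpanSingleton'_apply_self _ _ _ _)

end Functional

/-! ### Weights escaping to infinity. -/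

open Filter Topology in
/-- Weighted means of approximately increasing sequences, whose weights escape to infinity, are
asymptotically invariant under shifts. -/
theorem false_of_weighted_means {J : Type*} [Nonempty J] {a : J → ℕ → ℝ} (ha0 : ∀ j l, 0 ≤ a j l)
    (ha1 : ∀ j, HasSum (a j) 1) (hahead : ∀ L : ℕ, ∀ ε > 0, ∃ j, ∑ l ∈ Finset.range L, a j l ≤ ε)
    {p : ℕ → ℝ} (hp : ∀ m j, Summable fun l => a j l * p (l + m))
    {b : ℕ → ℕ → ℝ} (hb1 : ∀ n, b n 0 = 1) (hb0 : ∀ n l, 0 ≤ b n l) (hbp : ∀ n l, b n l ≤ p l)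
    {e : ℕ → ℝ} (he : Tendsto e atTop (𝓝 0)) (hstep : ∀ n l, b n l ≤ b n (l + 1) + p l * e n)
    {C D Q : ℝ} (hD : 0 ≤ D) {M : ℕ} (hC : ∀ j n, ∑' l, a j l * b n l ≤ C)
    (hmain : ∀ j n, ∑' l, a j l * b n l ≤
      D * (∑' l, a j l * b n (l + M) - ∑' l, a j l * b n l + C * Q * e n) + 1 / 4) : False := by
  obtain ⟨β, -, s, hs, hβ⟩ := (isCompact_univ_pi fun l =>
    isCompact_Icc (a := (0 : ℝ)) (b := p l)).tendsto_subseq (x := b)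
    fun n l _ => ⟨hb0 n l, hbp n l⟩
  have hβl : ∀ l, Tendsto (fun n => b (s n) l) atTop (𝓝 (β l)) := fun l =>
    (tendsto_pi_nhds.1 hβ l)
  have hes : Tendsto (fun n => e (s n)) atTop (𝓝 0) := he.comp hs.tendsto_atTop
  have hβ0 : ∀ l, 0 ≤ β l := fun l => ge_of_tendsto' (hβl l) fun n => hb0 _ l
  have hβp : ∀ l, β l ≤ p l := fun l => le_of_tendsto' (hβl l) fun n => hbp _ l
  have hβ1 : β 0 = 1 := tendsto_nhds_unique (hβl 0) (by simp [hb1])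
  have hmono : Monotone β := monotone_nat_of_le_succ fun l => by
    have := (hβl (l + 1)).add (hes.const_mul (p l))
    rw [mul_zero, add_zero] at this
    exact le_of_tendsto_of_tendsto' (hβl l) this fun n => hstep _ l
  have hsumβ : ∀ m j, Summable fun l => a j l * β (l + m) := fun m j =>
    Summable.of_nonneg_of_le (fun l => mul_nonneg (ha0 j l) (hβ0 _))
      (fun l => mul_le_mul_of_nonneg_left (hβp _) (ha0 j l)) (hp m j)
  have hlim : ∀ m j, Tendsto (fun n => ∑' l, a j l * b (s n) (l + m)) atTop
      (𝓝 (∑' l, a j l * β (l + m))) := fun m j => by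
    refine tendsto_tsum_of_dominated_convergence (hp m j) (fun l => (hβl _).const_mul _)
      (Eventually.of_forall fun n l => ?_)
    rw [Real.norm_of_nonneg (mul_nonneg (ha0 j l) (hb0 _ _))]
    exact mul_le_mul_of_nonneg_left (hbp _ _) (ha0 j l)
  have hlim0 := hlim 0
  have hsumβ0 := hsumβ 0
  simp only [add_zero] at hlim0 hsumβ0
  have hCβ : ∀ j, ∑' l, a j l * β l ≤ C := fun j => le_of_tendsto' (hlim0 j) fun n => hC j _
  have hmainβ : ∀ j, ∑' l, a j l * β l ≤
      D * (∑' l, a j l * β (l + M) - ∑' l, a j l * β l) + 1 / 4 := fun j => by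
    have h1 := ((((hlim M j).sub (hlim0 j)).add (hes.const_mul (C * Q))).const_mul D).add_const
      (1 / 4)
    rw [mul_zero, add_zero] at h1
    exact le_of_tendsto_of_tendsto' (hlim0 j) h1 fun n => hmain j _
  have hone : ∀ j, 1 ≤ ∑' l, a j l * β l := fun j => by
    rw [← (ha1 j).tsum_eq]
    refine (ha1 j).summable.tsum_le_tsum (fun l => ?_) (hsumβ0 j)
    have : 1 ≤ β l := hβ1 ▸ hmono (Nat.zero_le l)
    exact le_mul_of_one_le_right (ha0 j l) this
  -- Some `a j` has at least half of its mass beyond `L`, where `β` is at least `β L`; the mean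
  -- bound `C` then controls `β L`.
  have hbdd : ∀ L, β L ≤ 2 * C := fun L => by
    obtain ⟨j, hj⟩ := hahead L (1 / 2) (by norm_num)
    have h1 : HasSum (fun l => (a j l - if l ∈ Finset.range L then a j l else 0) * β L)
        ((1 - ∑ l ∈ Finset.range L, a j l) * β L) := by
      refine ((ha1 j).sub ?_).mul_right _
      have : ∑ l ∈ Finset.range L, a j l =
          ∑ l ∈ Finset.range L, if l ∈ Finset.range L then a j l else 0 :=
        Finset.sum_congr rfl fun l hl => by rw [if_pos hl]
      rw [this]
      exact hasSum_sum_of_ne_finset_zero fun l hl => if_neg hl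
    have h2 : (1 - ∑ l ∈ Finset.range L, a j l) * β L ≤ ∑' l, a j l * β l := by
      rw [← h1.tsum_eq]
      refine h1.summable.tsum_le_tsum (fun l => ?_) (hsumβ0 j)
      split_ifs with hl
      · rw [sub_self, zero_mul]; exact mul_nonneg (ha0 j l) (hβ0 l)
      · rw [sub_zero]
        exact mul_le_mul_of_nonneg_left (hmono (by simpa using hl)) (ha0 j l)
    have h3 := hCβ j
    have h4 : 1 / 2 * β L ≤ (1 - ∑ l ∈ Finset.range L, a j l) * β L :=
      mul_le_mul_of_nonneg_right (by linarith) (hβ0 L)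
    linarith
  have hC0 : 0 < 2 * C := by
    have := hbdd 0
    rw [hβ1] at this
    linarith
  have hconv := tendsto_atTop_ciSup hmono ⟨2 * C, by rintro _ ⟨l, rfl⟩; exact hbdd l⟩
  -- Chosen so that `D * (2 * ε) ≤ 1 / 2`. One `ε` pays for the increments of `β` beyond `L`, the
  -- other for the mass that `a j` has before `L`.
  set ε : ℝ := 1 / (4 * (D + 1)) with hε
  have hε0 : 0 < ε := by positivity
  obtain ⟨L, hL⟩ := (hconv.eventually_const_lt (sub_lt_self (⨆ l, β l) hε0)).exists
  have hsup : ∀ l, β l ≤ ⨆ l, β l := le_ciSup ⟨2 * C, by rintro _ ⟨l, rfl⟩; exact hbdd l⟩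
  obtain ⟨j, hj⟩ := hahead L (ε / (2 * C)) (by positivity)
  have h1 : HasSum (fun l => a j l * ε + (if l ∈ Finset.range L then a j l else 0) * (2 * C))
      (1 * ε + (∑ l ∈ Finset.range L, a j l) * (2 * C)) := by
    refine ((ha1 j).mul_right _).add (HasSum.mul_right _ ?_)
    have : ∑ l ∈ Finset.range L, a j l =
        ∑ l ∈ Finset.range L, if l ∈ Finset.range L then a j l else 0 :=
      Finset.sum_congr rfl fun l hl => by rw [if_pos hl]
    rw [this]
    exact hasSum_sum_of_ne_finset_zero fun l hl => if_neg hl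
  have h2 : ∑' l, a j l * β (l + M) - ∑' l, a j l * β l ≤
      1 * ε + (∑ l ∈ Finset.range L, a j l) * (2 * C) := by
    rw [← h1.tsum_eq, ← (hsumβ M j).tsum_sub (hsumβ0 j)]
    refine ((hsumβ M j).sub (hsumβ0 j)).tsum_le_tsum (fun l => ?_) h1.summable
    rw [← mul_sub]
    split_ifs with hl
    · have : β (l + M) - β l ≤ ε + 2 * C := by linarith [hbdd (l + M), hβ0 l]
      calc _ ≤ a j l * (ε + 2 * C) := mul_le_mul_of_nonneg_left this (ha0 j l)
        _ = _ := by ring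
    · rw [zero_mul, add_zero]
      refine mul_le_mul_of_nonneg_left ?_ (ha0 j l)
      have : β L ≤ β l := hmono (by simpa using hl)
      linarith [hsup (l + M)]
  have h3 : (∑ l ∈ Finset.range L, a j l) * (2 * C) ≤ ε := by
    rwa [le_div_iff₀ hC0] at hj
  have h4 : D * (∑' l, a j l * β (l + M) - ∑' l, a j l * β l) ≤ D * (2 * ε) :=
    mul_le_mul_of_nonneg_left (by linarith) hD
  have h5 : D * (2 * ε) ≤ 1 / 2 := by
    rw [hε, mul_one_div, mul_div_assoc', div_le_iff₀ (by positivity)]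
    linarith
  linarith [hone j, hmainβ j]

/-- The weights are the Taylor coefficients at `0`. Their sum is `f j 1 = 1`, and since `2⁻ˡ ≥ 2⁻ᴸ`
for `l < L`, smallness of `f j (1/2)` makes the first `L` weights small. -/
theorem IsWeightingScheme.coefficients {E : Type*} [NormedAddCommGroup E] [NormedSpace ℂ E]
    [CompleteSpace E] {J : Type w} [Preorder J] [IsDirectedOrder J] [Nonempty J] {f : J → ℂ → ℂ}
    (hf : IsWeightingScheme f) {T : E →L[ℂ] E} (hr : spectralRadius ℂ T = 1) {S : J → E →L[ℂ] E}
    (hS : ∀ j, IsAnalyticCalculus T (f j) (S j)) :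
    ∃ a : J → ℕ → ℝ, (∀ j l, 0 ≤ a j l) ∧ (∀ j, HasSum (a j) 1) ∧
      (∀ L : ℕ, ∀ ε > 0, ∃ j, ∑ l ∈ Finset.range L, a j l ≤ ε) ∧
      (∀ j, HasSum (fun l => (a j l : ℂ) • T ^ l) (S j)) ∧
      ∀ j, Summable fun l => a j l * ‖T ^ l‖ := by
  set a : J → ℕ → ℝ := fun j l => (iteratedDeriv l (f j) 0).re / l.factorial with ha
  have ha0 : ∀ j l, 0 ≤ a j l := fun j l => div_nonneg (hf.deriv_nonneg j l).1 (by positivity)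
  have hac : ∀ j l, iteratedDeriv l (f j) 0 / l.factorial = (a j l : ℂ) := fun j l => by
    have h := (hf.deriv_nonneg j l).2
    rw [ha]
    push_cast
    congr 1
    exact Complex.ext (by simp) (by simpa using h)
  have htaylor : ∀ j, ∀ t : ℝ, |t| ≤ 1 → HasSum (fun l => a j l * t ^ l) (f j t).re := by
    intro j t ht
    obtain ⟨R, hR, hfR, -⟩ := hS j
    rw [hr, ← ENNReal.ofReal_one, ENNReal.ofReal_lt_ofReal_iff_of_nonneg zero_le_one] at hR
    have h1 := Complex.hasSum_taylorSeries_on_ball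
      (hfR.differentiableOn.mono Metric.ball_subset_closedBall) (z := (t : ℂ))
      (by simpa using ht.trans_lt hR)
    have h2 := Complex.reCLM.hasSum h1
    refine h2.congr_fun fun l => ?_
    have h3 : iteratedDeriv l (f j) 0 = (l.factorial : ℂ) * (a j l : ℂ) := by
      rw [← hac, mul_div_cancel₀ _ (by exact_mod_cast l.factorial_ne_zero)]
    have h4 : ((l.factorial : ℂ))⁻¹ • ((t : ℂ) - 0) ^ l • iteratedDeriv l (f j) 0 =
        ((a j l * t ^ l : ℝ) : ℂ) := by
      have : (l.factorial : ℂ) ≠ 0 := by exact_mod_cast l.factorial_ne_zero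
      rw [h3, sub_zero, smul_eq_mul, smul_eq_mul]
      push_cast
      field_simp
    rw [h4]
    rfl
  refine ⟨a, ha0, fun j => ?_, fun L ε hε => ?_, fun j => ?_, fun j => ?_⟩
  · simpa [hf.map_one] using htaylor j 1 (by simp)
  · have h1 := hf.tendsto_zero ((1 / 2 : ℝ) : ℂ) (by
      rw [Complex.norm_real, Real.norm_of_nonneg (by norm_num)]; norm_num)
    obtain ⟨j, hj⟩ := (h1.eventually_lt_const (show 0 < ε * (1 / 2) ^ L by positivity)).exists
    refine ⟨j, ?_⟩
    have h2 := htaylor j (1 / 2) (by rw [abs_of_pos] <;> norm_num)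
    have h3 := sum_le_hasSum (Finset.range L)
      (fun l _ => mul_nonneg (ha0 j l) (by positivity)) h2
    have h4 : (∑ l ∈ Finset.range L, a j l) * (1 / 2) ^ L ≤
        ∑ l ∈ Finset.range L, a j l * (1 / 2) ^ l := by
      rw [Finset.sum_mul]
      refine Finset.sum_le_sum fun l hl => mul_le_mul_of_nonneg_left ?_ (ha0 j l)
      exact pow_le_pow_of_le_one (by norm_num) (by norm_num) (Finset.mem_range.1 hl).le
    have h5 := (Complex.re_le_norm (f j ((1 / 2 : ℝ) : ℂ))).trans hj.le
    exact le_of_mul_le_mul_right (h4.trans (h3.trans h5)) (by positivity)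
  · simpa only [hac] using (hS j).hasSum.1
  · refine (hS j).hasSum.2.congr fun l => ?_
    rw [hac, Complex.norm_real, Real.norm_of_nonneg (ha0 j l)]

namespace ComplexBanachLattice

variable {X E : Type*}
  [NormedAddCommGroup X] [Lattice X] [IsOrderedAddMonoid X] [HasSolidNorm X]
  [NormedSpace ℝ X] [IsOrderedModule ℝ X] [CompleteSpace X]
  [NormedAddCommGroup E] [NormedSpace ℂ E] [CompleteSpace E]
  {L : ComplexBanachLattice X E} {T : E →L[ℂ] E}

theorem realRestrict_one (x : X) : L.realRestrict 1 x = x := L.re_ofReal x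

/-- The triangle inequality for `l • x = T x - (T x - l • x)`. It makes the orbit of the modulus of
`x` under `T` increasing up to small errors. -/
theorem IsPositive.modulus_le_map_add (hT : L.IsPositive T) {l : ℂ} (hl : ‖l‖ = 1) (x : E) :
    L.modulus x ≤ L.realRestrict T (L.modulus x) + L.modulus (T x - l • x) := by
  have hl0 : l ≠ 0 := norm_ne_zero_iff.1 (by rw [hl]; simp)
  have h1 : x = l⁻¹ • (T x + (-1 : ℂ) • (T x - l • x)) := by
    rw [neg_one_smul, ← sub_eq_add_neg, sub_sub_cancel, smul_smul, inv_mul_cancel₀ hl0, one_smul]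
  calc L.modulus x = L.modulus (l⁻¹ • (T x + (-1 : ℂ) • (T x - l • x))) := by rw [← h1]
    _ ≤ L.modulus (T x + (-1 : ℂ) • (T x - l • x)) :=
      L.modulus_smul_le (by rw [norm_inv, hl, inv_one]) _
    _ ≤ L.modulus (T x) + L.modulus ((-1 : ℂ) • (T x - l • x)) := L.modulus_add_le _ _
    _ ≤ _ := add_le_add (hT.modulus_map_le x) (L.modulus_smul_le (by simp) _)

/-- If `l ^ k` is a resolvent value, then the modulus of an approximate eigenvector for `l` is
controlled by its growth under the operator. -/
theorem IsPositive.exists_modulus_le (hT : L.IsPositive T) {l : ℂ} (hl : ‖l‖ = 1) {k : ℤ} {D : ℝ}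
    (hD : ∀ z : E, z ≠ 0 → ∃ u : E, L.modulus u = L.modulus z ∧
      L.modulus (T u - l ^ k • u) ≤ D • (L.realRestrict T (L.modulus z) - L.modulus z +
        (2 : ℝ) • L.modulus (T z - l • z)))
    (hlk : l ^ k ∉ spectrum ℂ T) {M : ℕ} {c : ℕ → ℂ} (hc : ∀ m, ‖c m‖ ≤ 1) {δ : ℝ}
    (hcδ : ‖resolvent T (l ^ k) - ∑ m ∈ Finset.range M, c m • T ^ m‖ ≤ δ) {x : E}
    (hx : ‖x‖ = 1) :
    ∃ g : X, ‖g‖ ≤ δ * (‖T‖ + 1) ∧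
      L.modulus x ≤ D • (L.realRestrict (T ^ M) (L.modulus x) - L.modulus x +
        ∑ m ∈ Finset.range M, L.realRestrict (T ^ m) ((2 : ℝ) • L.modulus (T x - l • x))) + g := by
  obtain ⟨u, hu, hw⟩ := hD x (norm_ne_zero_iff.1 (by rw [hx]; simp))
  set w := T u - l ^ k • u with hwdef
  set P := ∑ m ∈ Finset.range M, c m • T ^ m with hP
  set R := resolvent T (l ^ k) with hR
  have hun : ‖u‖ = 1 := by rw [← L.norm_modulus, hu, L.norm_modulus, hx]
  have hwn : ‖w‖ ≤ ‖T‖ + 1 := by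
    refine (norm_sub_le _ _).trans (add_le_add ?_ ?_)
    · simpa [hun] using T.le_opNorm u
    · rw [norm_smul, norm_zpow, hl, one_zpow, one_mul, hun]
  have hRu : (-1 : ℂ) • R w = u := by
    have h1 : R * (algebraMap ℂ (E →L[ℂ] E) (l ^ k) - T) = 1 := by
      have : IsUnit (algebraMap ℂ (E →L[ℂ] E) (l ^ k) - T) := by
        by_contra h; exact hlk h
      exact Ring.inverse_mul_cancel _ this
    have h2 := congrArg (fun A : E →L[ℂ] E => A u) h1
    have h3 : (algebraMap ℂ (E →L[ℂ] E) (l ^ k) - T) u = (-1 : ℂ) • w := by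
      rw [hwdef, neg_one_smul, neg_sub]; rfl
    simp only [mul_apply_eq_comp] at h2
    rw [h3, map_smul] at h2
    exact h2
  refine ⟨L.modulus ((R - P) w), ?_, ?_⟩
  · rw [L.norm_modulus]
    exact ((R - P).le_opNorm w).trans (mul_le_mul hcδ hwn (norm_nonneg _)
      ((norm_nonneg _).trans hcδ))
  have hdecomp : u = (-1 : ℂ) • (∑ m ∈ Finset.range M, c m • (T ^ m) w + (R - P) w) := by
    have : P w = ∑ m ∈ Finset.range M, c m • (T ^ m) w := by
      simp [hP]
    rw [← this, sub_apply, add_sub_cancel, hRu]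
  have hsum : L.modulus u ≤ ∑ m ∈ Finset.range M, L.realRestrict (T ^ m) (L.modulus w) +
      L.modulus ((R - P) w) := by
    conv_lhs => rw [hdecomp]
    refine (L.modulus_smul_le (by simp) _).trans ((L.modulus_add_le _ _).trans ?_)
    refine add_le_add ((L.modulus_sum_le _ _).trans (Finset.sum_le_sum fun m _ => ?_)) le_rfl
    exact (L.modulus_smul_le (hc m) _).trans ((hT.pow m).modulus_map_le w)
  rw [← hu]
  refine hsum.trans (add_le_add ?_ le_rfl)
  rw [hu]
  -- Applying `T ^ m` to the bound on the modulus of `w` produces consecutive differences of the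
  -- orbit of the modulus of `x`, which telescope. This needs equal weights, hence the bound `1` on
  -- all coefficients `c m`.
  calc ∑ m ∈ Finset.range M, L.realRestrict (T ^ m) (L.modulus w)
      ≤ ∑ m ∈ Finset.range M, L.realRestrict (T ^ m) (D • (L.realRestrict T (L.modulus x) -
        L.modulus x + (2 : ℝ) • L.modulus (T x - l • x))) :=
        Finset.sum_le_sum fun m _ => (hT.pow m).realRestrict_mono hw
    _ = D • (∑ m ∈ Finset.range M, (L.realRestrict (T ^ (m + 1)) (L.modulus x) -
        L.realRestrict (T ^ m) (L.modulus x)) +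
        ∑ m ∈ Finset.range M, L.realRestrict (T ^ m) ((2 : ℝ) • L.modulus (T x - l • x))) := by
        rw [← Finset.sum_add_distrib, Finset.smul_sum]
        refine Finset.sum_congr rfl fun m _ => ?_
        rw [map_smul, map_add, map_sub, pow_succ, hT.realRestrict_mul]
    _ = _ := by
        rw [Finset.sum_range_sub (fun m => L.realRestrict (T ^ m) (L.modulus x)), pow_zero,
          realRestrict_one]

theorem hasSum_realRestrict_apply {a : ℕ → ℝ} {S : E →L[ℂ] E}
    (h : HasSum (fun l => (a l : ℂ) • T ^ l) S) (x : X) :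
    HasSum (fun l => a l • L.realRestrict (T ^ l) x) (L.realRestrict S x) := by
  have h1 := (L.re ∘L
    ((ContinuousLinearMap.apply ℂ E (L.ofReal x)).restrictScalars ℝ)).hasSum h
  refine h1.congr_fun fun l => ?_
  change a l • L.re ((T ^ l) (L.ofReal x)) = L.re ((a l : ℂ) • (T ^ l) (L.ofReal x))
  rw [Complex.coe_smul, map_smul]

theorem IsPositive.zpow_mem_spectrum (hT : L.IsPositive T) (hr : spectralRadius ℂ T = 1)
    (hws : IsWSBounded.{w} T) {l : ℂ} (hl : ‖l‖ = 1) (hlT : l ∈ spectrum ℂ T) (k : ℤ) :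
    l ^ k ∈ spectrum ℂ T := by
  by_contra hlk
  obtain ⟨J, _, _, hJ, f, hf, C, hC⟩ := hws
  choose S hS hSC using hC
  have hC0 : 0 ≤ C := (norm_nonneg _).trans (hSC hJ.some)
  obtain ⟨a, ha0, ha1, hahead, haS, hap⟩ := hf.coefficients hr hS
  obtain ⟨D, hD0, hD⟩ := hT.exists_modulus_zpow_eigenvector_le k
  -- The remainder `g` then has norm at most `1 / (4 * (C + 1))`, so `S j` contributes at most `1 /
  -- 4` from it; `C + 1` avoids division by zero.
  have hδ : 0 < 1 / (4 * (C + 1) * (‖T‖ + 1)) := by positivity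
  obtain ⟨M, c, hc, hcδ⟩ := exists_sum_pow_near_resolvent hr
    (by rw [norm_zpow, hl, one_zpow]) hlk hδ
  have hx : ∀ n : ℕ, ∃ x : E, ‖x‖ = 1 ∧ ‖T x - l • x‖ ≤ 1 / ((n : ℝ) + 1) := fun n =>
    exists_approximate_eigenvector hr hl hlT (by positivity)
  choose x hx1 hxl using hx
  have hne : ∀ n, L.modulus (x n) ≠ 0 := fun n => by
    rw [← norm_ne_zero_iff, norm_modulus, hx1]; exact one_ne_zero
  choose φ hφ0 hφ1 hφx using fun n => exists_positive_functional (L.modulus_nonneg (x n)) (hne n)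
  have hφmono : ∀ n {y z : X}, y ≤ z → φ n y ≤ φ n z := fun n y z h => by
    have := hφ0 n _ (sub_nonneg.2 h)
    rwa [map_sub, sub_nonneg] at this
  have hφsum : ∀ j n y, HasSum (fun i => a j i * φ n (L.realRestrict (T ^ i) y))
      (φ n (L.realRestrict (S j) y)) := fun j n y => by
    have hcont : Continuous (φ n) :=
      ((φ n).mkContinuous 1 fun y => by
        rw [one_mul, Real.norm_eq_abs, abs_le]
        refine ⟨?_, hφ1 n y⟩
        have := hφ1 n (-y)
        rw [map_neg, norm_neg] at this
        linarith).continuous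
    have h1 := (hasSum_realRestrict_apply (L := L) (haS j) y).map (φ n) hcont
    refine h1.congr_fun fun i => ?_
    simp
  have hSpos : ∀ j n {y : X}, 0 ≤ y → 0 ≤ φ n (L.realRestrict (S j) y) := fun j n y hy =>
    (hφsum j n y).nonneg fun i =>
      mul_nonneg (ha0 j i) (hφ0 n _ ((hT.pow i).realRestrict_nonneg hy))
  have hSmono : ∀ j n {y z : X}, y ≤ z →
      φ n (L.realRestrict (S j) y) ≤ φ n (L.realRestrict (S j) z) := fun j n y z h => by
    have := hSpos j n (sub_nonneg.2 h)
    rwa [map_sub, map_sub, sub_nonneg] at this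
  have hSle : ∀ j n y, φ n (L.realRestrict (S j) y) ≤ C * ‖y‖ := fun j n y =>
    (hφ1 n _).trans ((norm_realRestrict_apply_le _ _).trans (by gcongr; exact hSC j))
  have hTM : ∀ i m y, L.realRestrict (T ^ (i + m)) y =
      L.realRestrict (T ^ i) (L.realRestrict (T ^ m) y) := fun i m y => by
    rw [pow_add, (hT.pow m).realRestrict_mul]
  have hmod1 : ∀ n, ‖L.modulus (x n)‖ = 1 := fun n => by rw [norm_modulus, hx1]
  -- The orbit of the modulus of `x n` is tested against its own norming functional, so that `b n 0
  -- = 1`. The `2` in `e` comes from the doubled error in `exists_modulus_le`, and `Q` collects the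
  -- norms of its `M` iterates.
  refine false_of_weighted_means ha0 ha1 hahead (p := fun i => ‖T ^ i‖) (fun m j => ?_)
    (b := fun n i => φ n (L.realRestrict (T ^ i) (L.modulus (x n)))) (fun n => ?_) (fun n i => ?_)
    (fun n i => ?_) (e := fun n => 2 * (1 / ((n : ℝ) + 1))) ?_ (fun n i => ?_) (C := C) (D := D)
    (Q := ∑ m ∈ Finset.range M, ‖T ^ m‖) hD0 (M := M) (fun j n => ?_) (fun j n => ?_)
  · refine Summable.of_nonneg_of_le (fun i => mul_nonneg (ha0 j i) (norm_nonneg _)) (fun i => ?_)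
      ((hap j).mul_right ‖T ^ m‖)
    rw [mul_assoc, pow_add]
    exact mul_le_mul_of_nonneg_left (norm_mul_le _ _) (ha0 j i)
  · rw [pow_zero, realRestrict_one, hφx, hmod1]
  · exact hφ0 n _ ((hT.pow i).realRestrict_nonneg (L.modulus_nonneg _))
  · refine (hφ1 n _).trans ((norm_realRestrict_apply_le _ _).trans_eq ?_)
    rw [hmod1, mul_one]
  · simpa using (tendsto_one_div_add_atTop_nhds_zero_nat (𝕜 := ℝ)).const_mul 2
  · have h1 := hφmono n ((hT.pow i).realRestrict_mono (hT.modulus_le_map_add hl (x n)))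
    rw [map_add, map_add, ← hT.realRestrict_mul, ← pow_succ] at h1
    refine h1.trans (add_le_add le_rfl ((hφ1 n _).trans ((norm_realRestrict_apply_le _ _).trans ?_)))
    gcongr
    rw [norm_modulus]
    have : (0 : ℝ) ≤ 1 / ((n : ℝ) + 1) := by positivity
    linarith [hxl n]
  · rw [(hφsum j n _).tsum_eq]
    exact (hSle j n _).trans_eq (by rw [hmod1, mul_one])
  · obtain ⟨g, hg, hle⟩ := hT.exists_modulus_le hl (hD l hl) hlk hc hcδ (hx1 n)
    have hsumM := hφsum j n (L.realRestrict (T ^ M) (L.modulus (x n)))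
    simp only [← hTM] at hsumM
    rw [(hφsum j n _).tsum_eq, hsumM.tsum_eq]
    have h1 := hSmono j n hle
    rw [map_add, map_smul, map_add, map_smul, map_add, map_add, map_sub, map_sub, smul_eq_mul] at h1
    refine h1.trans (add_le_add (mul_le_mul_of_nonneg_left (add_le_add le_rfl ?_) hD0) ?_)
    · refine (hSle j n _).trans ?_
      rw [mul_assoc]
      refine mul_le_mul_of_nonneg_left ?_ hC0
      rw [Finset.sum_mul]
      refine (norm_sum_le _ _).trans (Finset.sum_le_sum fun m _ => ?_)
      refine (norm_realRestrict_apply_le _ _).trans ?_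
      gcongr
      rw [norm_smul, norm_modulus, Real.norm_of_nonneg zero_le_two]
      gcongr
      exact hxl n
    · refine (hSle j n g).trans ?_
      calc C * ‖g‖ ≤ (C + 1) * (1 / (4 * (C + 1) * (‖T‖ + 1)) * (‖T‖ + 1)) := by
            gcongr
            linarith
        _ = 1 / 4 := by field_simp

end ComplexBanachLattice

theorem mainTheorem5 {X E : Type*}
    [NormedAddCommGroup X] [Lattice X] [IsOrderedAddMonoid X] [HasSolidNorm X]
    [NormedSpace ℝ X] [IsOrderedModule ℝ X] [CompleteSpace X]
    [NormedAddCommGroup E] [NormedSpace ℂ E] [CompleteSpace E]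
    (L : ComplexBanachLattice X E) (T : E →L[ℂ] E)
    (hr : spectralRadius ℂ T = 1) (hpos : L.IsPositive T) (hws : IsWSBounded.{w} T) :
    IsCyclicSet (peripheralSpectrum T) := by
  intro r θ hr0 ⟨hmem, hnorm⟩ k
  have hexp : ∀ t : ℝ, ‖Complex.exp (Complex.I * t)‖ = 1 := fun t => by
    rw [mul_comm, Complex.norm_exp_ofReal_mul_I]
  have hr1 : r = 1 := by
    rwa [hr, norm_mul, hexp, mul_one, Complex.norm_real, Real.norm_of_nonneg hr0,
      ENNReal.ofReal_eq_one] at hnorm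
  subst hr1
  rw [Complex.ofReal_one, one_mul] at hmem ⊢
  have hpow : Complex.exp (Complex.I * k * θ) = Complex.exp (Complex.I * θ) ^ k := by
    rw [← Complex.exp_int_mul]
    congr 1
    ring
  rw [hpow]
  refine ⟨hpos.zpow_mem_spectrum hr hws (hexp θ) hmem k, ?_⟩
  rw [norm_zpow, hexp, one_zpow, hr, ENNReal.ofReal_one]
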